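/- Setting. Plotkin's calculus: $\lambda$-terms up to $\alpha$-equivalence; values are variables and abstractions; right v-contexts are $R ::= \langle\cdot\rangle \mid tR \mid Rv$; and $R\langle(\lambda x.t)v\rangle \to_{\beta_v} R\langle t\{x\leftarrow v\}\rangle$ for $v$ a value (weak, right-to-left call-by-value). Finest crumbled calculus: bites are $b ::= xy \mid v$, crumbled values are $v ::= \lambda x.[*\leftarrow y] \mid \lambda x.E$ with $E$ a crumble; an environment is a sequence of entries $[x\leftarrow b]$, where $[x\leftarrow b]$ binds $x$ in everything to its left; a crumble is an environment whose leftmost entry, and no other, is an assignment to the special variable $*$. A v-environment $E_v$ is an environment all of whose entries are crumbled values, and $E_v(x)$ is the value assigned to $x$ in $E_v$. A crumble is well-named if the variables in its domain (the variables it assigns to) are pairwise distinct and not $\lambda$-bound in it and, whenever it is $E_1[z\leftarrow b]E_2$, $z$ is not free in $b$ or $E_2$. The rules are $$E[z\leftarrow xy]E_v \to_{m_1} E[z\leftarrow b']E'E_v, \qquad E[z\leftarrow xy]E_v \to_{m_2} E[z\leftarrow E_v(y_1')]E_v,$$ where $z$ may be $*$. In the first, $\lambda x_1.[*\leftarrow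 b]E''$ is an $\alpha$-variant of $E_v(x)$ whose body has a domain of fresh variables, chosen so that the resulting concatenation is well-named, and $([*\leftarrow b]E'')\{x_1\leftarrow y\} = [*\leftarrow b']E'$ without capture of $y$. In the second, $E_v(x)=\lambda x_1.[*\leftarrow y_1]$ and $y_1'=y_1\{x_1\leftarrow y\}$. Put $\to_{Cr} = \to_{m_1}\cup\to_{m_2}$. The crumbling $\lceil t\rceil$ of a term $t$ that is not a variable is given, with globally fresh $x,y$ where these are introduced and with $u,u'$ not variables, $\lceil u\rceil=[*\leftarrow b]E$, $\lceil u'\rceil=[*\leftarrow b']E'$, by $\lceil xy\rceil=[*\leftarrow xy]$, $\lceil\lambda x.y\rceil=[*\leftarrow\lambda x.[*\leftarrow y]]$, $\lceil\lambda x.u\rceil=[*\leftarrow\lambda x.\lceil u\rceil]$, $\lceil uy\rceil=[*\leftarrow xy][x\leftarrow b]E$ ($x$ introduced), $\lceil xu'\rceil=[*\leftarrow xy][y\leftarrow b']E'$ ($y$ introduced), $\lceil uu'\rceil=[*\leftarrow xy][x\leftarrow b]E[y\leftarrow b']E'$ ($x,y$ introduced). The read-back is $(xy)_\downarrow=xy$,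 $(\lambda x.[*\leftarrow y])_\downarrow=\lambda x.y$, $(\lambda x.E)_\downarrow=\lambda x.E_\downarrow$, $[*\leftarrow b]_\downarrow=b_\downarrow$, $(E[x\leftarrow b])_\downarrow=E_\downarrow\{x\leftarrow b_\downarrow\}$. A crumble is reachable if it is obtained by finitely many $\to_{Cr}$-steps from $\lceil t\rceil$ for some closed term $t$. Crumbles are considered up to $\alpha$-equivalence, for every choice of fresh variables. Theorem (Implementation System). The machine whose states are the reachable crumbles, with principal transitions $\to_{m_1}\cup\to_{m_2}$ and no overhead transitions, the strategy $\to_{\beta_v}$ on closed terms (which is deterministic), and the read-back form an implementation system: $\alpha$-equivalence is an equivalence relation that the read-back respects, reachable crumbles read back to closed terms, and 1. (Initialization) every closed term $t$ has a crumbling, unique up to $\alpha$-equivalence, and $\lceil t\rceil_\downarrow=t$; 2. (Principal projection) if $E$ is reachable and $E\to_{Cr}E'$ then $E_\downarrow\to_{\beta_v}E'_\downarrow$; 3. (Determinism) if $E_1,E_2$ are $\alpha$-equivalent reachable crumbles, $E_1\to_{Cr}E_1'$ and $E_2\to_{Cr}E_2'$, then $E_1',E_2'$ are $\alpha$-equivalent;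 4. (Halt) if $E$ is reachable and $\to_{Cr}$-normal then $E_\downarrow$ is $\to_{\beta_v}$-normal (the two conditions on overhead transitions, that they leave the read-back unchanged and terminate, hold trivially). Consequently, for every closed $t$ and every $n$: if $\lceil t\rceil\to_{Cr}^n E$ then $t\to_{\beta_v}^n E_\downarrow$; and if $t\to_{\beta_v}^n u$ then there is a crumble $E$ with $\lceil t\rceil\to_{Cr}^n E$ and $E_\downarrow=u$. -/

import Mathlib

namespace Crumbling

/-- Variables. The special variable `*` is not a member of this type: an assignment to `*` occurs
exactly once in a crumble, leftmost, and is the constructor `Crumble.ret`. -/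
abbrev Var : Type := ℕ

/-! ### Plotkin's call-by-value calculus -/

/-- λ-terms in locally nameless form: bound variables are de Bruijn indices, free variables are
names, so that α-equivalent terms are equal. Genuine terms are those with `lcAt 0`. -/
inductive Term : Type
  | bvar (i : ℕ)
  | fvar (x : Var)
  | lam (t : Term)
  | app (t u : Term)

namespace Term

/-- All de Bruijn indices are bound, up to `k` dangling ones. -/
def lcAt : ℕ → Term → Prop
  | k, bvar i => i < k
  | _, fvar _ => True
  | k, lam t => lcAt (k + 1) t
  | k, app t u => lcAt k t ∧ lcAt k u

/-- The free variables of a term. -/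
def fv : Term → Finset Var
  | bvar _ => ∅
  | fvar x => {x}
  | lam t => fv t
  | app t u => fv t ∪ fv u

/-- Closed λ-terms. -/
def Closed (t : Term) : Prop := lcAt 0 t ∧ fv t = ∅

/-- Replace the index `k` by `u`. -/
def openAt (u : Term) : ℕ → Term → Term
  | k, bvar i => if i = k then u else bvar i
  | _, fvar x => fvar x
  | k, lam t => lam (openAt u (k + 1) t)
  | k, app t s => app (openAt u k t) (openAt u k s)

/-- Replace the free variable `x` by the index `k`. -/
def closeAt (x : Var) : ℕ → Term → Term
  | _, bvar i => bvar i
  | k, fvar y => if y = x then bvar k else fvar y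
  | k, lam t => lam (closeAt x (k + 1) t)
  | k, app t s => app (closeAt x k t) (closeAt x k s)

/-- The abstraction `λx. t` of the name `x` in `t`. -/
def abs (x : Var) (t : Term) : Term := lam (closeAt x 0 t)

/-- The substitution `t{x ← u}` of a free variable. It is capture-avoiding for locally closed `u`,
because bound variables are not names. -/
def subst (x : Var) (u : Term) : Term → Term
  | bvar i => bvar i
  | fvar y => if y = x then u else fvar y
  | lam t => lam (subst x u t)
  | app t s => app (subst x u t) (subst x u s)

/-- Values: variables and abstractions. -/
def IsValue : Term → Prop
  | fvar _ => True
  | lam _ => True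
  | _ => False

end Term

/-- Right v-contexts `R ::= ⟨·⟩ | t R | R v`. -/
inductive RCtx : Type
  | hole
  | appR (t : Term) (R : RCtx)
  | appL (R : RCtx) (v : Term) (hv : v.IsValue)

/-- Plugging a term in the hole of a right v-context. -/
def RCtx.plug : RCtx → Term → Term
  | hole, s => s
  | appR t R, s => .app t (R.plug s)
  | appL R v _, s => .app (R.plug s) v

/-- Weak right-to-left call-by-value reduction: `R⟨(λx.t) v⟩ →βv R⟨t{x ← v}⟩`. -/
def BetaV (s s' : Term) : Prop :=
  ∃ (R : RCtx) (t v : Term), v.IsValue ∧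
    s = R.plug (.app (.lam t) v) ∧ s' = R.plug (Term.openAt v 0 t)

/-! ### The finest crumbled calculus -/

mutual
/-- Bites: `x y`, `λx.[* ← y]`, and `λx.E` for a crumble `E`. -/
inductive Bite : Type
  | app (x y : Var)
  | lamVar (x y : Var)
  | lam (x : Var) (E : Crumble)
/-- Crumbles: environments whose leftmost entry, and no other one, is an assignment to `*`.
`ret b` is `[* ← b]` and `snoc E x b` is `E[x ← b]`. -/
inductive Crumble : Type
  | ret (b : Bite)
  | snoc (E : Crumble) (x : Var) (b : Bite)
end

/-- Environments without an assignment to `*`, the leftmost entry first. -/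
abbrev Env : Type := List (Var × Bite)

/-- Crumbled values are the two kinds of abstraction. -/
def Bite.IsValue : Bite → Prop
  | .app _ _ => False
  | .lamVar _ _ => True
  | .lam _ _ => True

/-- v-environments: every entry is a value. -/
def Env.IsV (E : Env) : Prop := ∀ e ∈ E, e.2.IsValue

/-- The concatenation `E E'` of a crumble and an environment. -/
def Crumble.append (E : Crumble) (E' : Env) : Crumble :=
  E'.foldl (fun c e => c.snoc e.1 e.2) E

/-- The bite `E(x)`: the leftmost entry for `x` (it is the one in whose scope an occurrence of `x`
to the left of `E` is). -/
def Env.get (x : Var) : Env → Option Bite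
  | [] => none
  | e :: E => if e.1 = x then some e.2 else Env.get x E

/-- Environment contexts that start with the assignment to `*`: `[* ← ⟨·⟩]` and `E[z ← ⟨·⟩]`. -/
inductive ECtx : Type
  | ret
  | snoc (E : Crumble) (z : Var)

/-- Plugging a bite. -/
def ECtx.plug : ECtx → Bite → Crumble
  | ret, b => .ret b
  | snoc E z, b => .snoc E z b

/-- Plugging a crumble: if `E' = [* ← b]E''` then `(E[z ← ⟨·⟩])⟨E'⟩` is `E[z ← b]E''`. -/
def ECtx.plugCrumble (C : ECtx) : Crumble → Crumble
  | .ret b => C.plug b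
  | .snoc E x b => .snoc (C.plugCrumble E) x b

mutual
/-- All variables that occur in a bite, in any role. -/
def Bite.names : Bite → Finset Var
  | .app x y => {x, y}
  | .lamVar x y => {x, y}
  | .lam x E => insert x E.names
/-- All variables that occur in a crumble, in any role. -/
def Crumble.names : Crumble → Finset Var
  | .ret b => b.names
  | .snoc E x b => insert x (E.names ∪ b.names)
end

/-- The domain of a crumble, without `*`, as a list. -/
def Crumble.dom : Crumble → List Var
  | .ret _ => []
  | .snoc E x _ => x :: E.dom

mutual
/-- Free variables of a bite. -/
def Bite.fv : Bite → Finset Var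
  | .app x y => {x, y}
  | .lamVar x y => {y} \ {x}
  | .lam x E => E.fv \ {x}
/-- Free variables of a crumble: an entry `[x ← b]` binds `x` in everything to its left. -/
def Crumble.fv : Crumble → Finset Var
  | .ret b => b.fv
  | .snoc E x b => (E.fv \ {x}) ∪ b.fv
end

/-- Free variables of an environment. -/
def Env.fv (E : Env) : Finset Var :=
  E.foldl (fun s e => (s \ {e.1}) ∪ e.2.fv) ∅

mutual
/-- The λ-bound variables of a bite, at all depths. -/
def Bite.bv : Bite → Finset Var
  | .app _ _ => ∅
  | .lamVar x _ => {x}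
  | .lam x E => insert x E.bv
/-- The λ-bound variables of a crumble, at all depths. -/
def Crumble.bv : Crumble → Finset Var
  | .ret b => b.bv
  | .snoc E _ b => E.bv ∪ b.bv
end

mutual
/-- The variables in the domains of the bodies inside a bite, with repetitions. -/
def Bite.allDom : Bite → List Var
  | .app _ _ => []
  | .lamVar _ _ => []
  | .lam _ E => E.allDom
/-- The variables in the domain of a crumble and in the domains of all bodies inside it, with
repetitions. -/
def Crumble.allDom : Crumble → List Var
  | .ret b => b.allDom
  | .snoc E x b => x :: (E.allDom ++ b.allDom)
end

/-- Well-named crumbles. -/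
def Crumble.WellNamed (E : Crumble) : Prop :=
  E.dom.Nodup ∧ (∀ x ∈ E.dom, x ∉ E.bv) ∧
    ∀ (E₁ : Crumble) (z : Var) (b : Bite) (E₂ : Env),
      E = (E₁.snoc z b).append E₂ → z ∉ b.fv ∧ z ∉ E₂.fv

mutual
/-- The substitution `b{x ← y}` of a variable for the free occurrences of a variable. It does not
rename binders, and is used only where `y` is not bound in `b`. -/
def Bite.subst (x y : Var) : Bite → Bite
  | .app u w => .app (if u = x then y else u) (if w = x then y else w)
  | .lamVar z w => if z = x then .lamVar z w else .lamVar z (if w = x then y else w)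
  | .lam z E => if z = x then .lam z E else .lam z (E.subst x y)
/-- The substitution `E{x ← y}`, with the same proviso. -/
def Crumble.subst (x y : Var) : Crumble → Crumble
  | .ret b => .ret (b.subst x y)
  | .snoc E z b => .snoc (if z = x then E else E.subst x y) z (b.subst x y)
end

/-- `VarAlpha Γ x y`: the occurrences `x` and `y` correspond to each other, where `Γ` lists the
pairs of corresponding binders in scope, innermost first. -/
def VarAlpha : List (Var × Var) → Var → Var → Prop
  | [], x, y => x = y
  | (u, w) :: Γ, x, y => (x = u ∧ y = w) ∨ (x ≠ u ∧ y ≠ w ∧ VarAlpha Γ x y)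

mutual
/-- α-equivalence of bites below the binders listed in the first argument. -/
def Bite.Alpha : List (Var × Var) → Bite → Bite → Prop
  | Γ, .app x y, .app x' y' => VarAlpha Γ x x' ∧ VarAlpha Γ y y'
  | Γ, .lamVar x y, .lamVar x' y' => VarAlpha ((x, x') :: Γ) y y'
  | Γ, .lam x E, .lam x' E' => E.Alpha ((x, x') :: Γ) E'
  | _, _, _ => False
/-- α-equivalence of crumbles below the binders listed in the first argument. Abstractions bind
their variable in their body, and an entry `[x ← b]` binds `x` in everything to its left. -/
def Crumble.Alpha : List (Var × Var) → Crumble → Crumble → Prop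
  | Γ, .ret b, .ret b' => b.Alpha Γ b'
  | Γ, .snoc E x b, .snoc E' x' b' => b.Alpha Γ b' ∧ E.Alpha ((x, x') :: Γ) E'
  | _, _, _ => False
end

/-! ### Crumbling and read-back -/

/-- The clauses of the crumbling translation, for an arbitrary choice of the variables it
introduces. There is no clause for variables: they are not translated. -/
inductive Translates : Term → Crumble → Prop
  | appVarVar (x y : Var) : Translates (.app (.fvar x) (.fvar y)) (.ret (.app x y))
  | lamVar (x y : Var) : Translates (.abs x (.fvar y)) (.ret (.lamVar x y))
  | lam (x : Var) (t : Term) (E : Crumble) (h : Translates t E) :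
      Translates (.abs x t) (.ret (.lam x E))
  | appVar (u : Term) (E : Crumble) (x y : Var) (h : Translates u E) :
      Translates (.app u (.fvar y)) ((ECtx.snoc (.ret (.app x y)) x).plugCrumble E)
  | varApp (u' : Term) (E' : Crumble) (x y : Var) (h : Translates u' E') :
      Translates (.app (.fvar x) u') ((ECtx.snoc (.ret (.app x y)) y).plugCrumble E')
  | app (u u' : Term) (E E' : Crumble) (x y : Var) (h : Translates u E) (h' : Translates u' E') :
      Translates (.app u u') ((ECtx.snoc
        ((ECtx.snoc (.ret (.app x y)) x).plugCrumble E) y).plugCrumble E')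

/-- `E` is the crumbling of `t`: it comes from the clauses, and the variables that these introduce
(those in the domains, at all depths) are globally fresh, that is pairwise distinct and different
from the free and from the λ-bound variables. -/
def Crumb (t : Term) (E : Crumble) : Prop :=
  Translates t E ∧ E.allDom.Nodup ∧ ∀ z ∈ E.allDom, z ∉ t.fv ∧ z ∉ E.bv

mutual
/-- Read-back of bites. -/
def Bite.readBack : Bite → Term
  | .app x y => .app (.fvar x) (.fvar y)
  | .lamVar x y => .abs x (.fvar y)
  | .lam x E => .abs x E.readBack
/-- Read-back of crumbles. -/
def Crumble.readBack : Crumble → Term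
  | .ret b => b.readBack
  | .snoc E x b => Term.subst x b.readBack E.readBack
end

/-! ### Reduction of crumbles -/

/-- `C⟨x y⟩Eᵥ →m1 C⟨E{x₁ ← y}⟩Eᵥ`, where `λx₁.E` is an α-variant of the abstraction `Eᵥ(x)` such
that the domain of `E` consists of fresh variables. If `C = E₀[z ← ⟨·⟩]` and
`E{x₁ ← y} = [* ← b']E'`, this is `E₀[z ← x y]Eᵥ →m1 E₀[z ← b']E'Eᵥ`. The α-variant is also such that
`y` is not captured by the substitution and the resulting concatenation is well-named. -/
inductive StepM1 : Crumble → Crumble → Prop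
  | mk (C : ECtx) (x y : Var) (Ev : Env) (v : Bite) (x₁ : Var) (E : Crumble)
      (hEv : Ev.IsV) (hx : Ev.get x = some v)
      (hα : v.Alpha [] (.lam x₁ E))
      (hfresh : ∀ w ∈ E.dom, w ∉ ((C.plug (.app x y)).append Ev).names)
      (hy : y ∉ E.bv ∧ y ∉ E.allDom)
      (hwn : ((C.plugCrumble (E.subst x₁ y)).append Ev).WellNamed) :
      StepM1 ((C.plug (.app x y)).append Ev) ((C.plugCrumble (E.subst x₁ y)).append Ev)

/-- `C⟨x y⟩Eᵥ →m2 C⟨Eᵥ(y₁')⟩Eᵥ`, where `Eᵥ(x) = λx₁.[* ← y₁]` and `y₁' = y₁{x₁ ← y}`. -/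
inductive StepM2 : Crumble → Crumble → Prop
  | mk (C : ECtx) (x y : Var) (Ev : Env) (x₁ y₁ : Var) (v : Bite)
      (hEv : Ev.IsV) (hx : Ev.get x = some (.lamVar x₁ y₁))
      (hv : Ev.get (if y₁ = x₁ then y else y₁) = some v) :
      StepM2 ((C.plug (.app x y)).append Ev) ((C.plug v).append Ev)

/-- The reduction `→Cr = →m1 ∪ →m2`. -/
def StepCr (E E' : Crumble) : Prop := StepM1 E E' ∨ StepM2 E E'

/-- Reachable crumbles. -/
def Reachable (E : Crumble) : Prop :=
  ∃ (t : Term) (E₀ : Crumble), t.Closed ∧ Crumb t E₀ ∧ Relation.ReflTransGen StepCr E₀ E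

/-! ### Implementation systems -/

/-- An abstract machine for a calculus with terms in `Λ`. States are considered up to `equiv`
(for example renaming of bound variables), and so is the encoding, which is therefore a relation. -/
structure Machine (Λ : Type) where
  State : Type
  equiv : State → State → Prop
  principal : State → State → Prop
  overhead : State → State → Prop
  encodes : Λ → State → Prop
  decode : State → Λ

/-- The transition relation of a machine. -/
def Machine.step {Λ : Type} (M : Machine Λ) (s s' : M.State) : Prop :=
  M.principal s s' ∨ M.overhead s s'

/-- Executions with `n` principal transitions (and any number of overhead transitions). -/
inductive Machine.Exec {Λ : Type} (M : Machine Λ) : ℕ → M.State → M.State → Prop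
  | refl (s : M.State) : Machine.Exec M 0 s s
  | principal {n : ℕ} {s s' s'' : M.State} (h : Machine.Exec M n s s')
      (hs : M.principal s' s'') : Machine.Exec M (n + 1) s s''
  | overhead {n : ℕ} {s s' s'' : M.State} (h : Machine.Exec M n s s')
      (hs : M.overhead s' s'') : Machine.Exec M n s s''

/-- Derivations of length `n`. -/
inductive Deriv {Λ : Type} (r : Λ → Λ → Prop) : ℕ → Λ → Λ → Prop
  | refl (t : Λ) : Deriv r 0 t t
  | tail {n : ℕ} {t u w : Λ} (h : Deriv r n t u) (hs : r u w) : Deriv r (n + 1) t w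

/-- The machine `M`, the strategy `r` on the terms in `T`, and the decoding of `M` form an
implementation system. -/
structure Machine.IsImplementationSystem {Λ : Type} (M : Machine Λ) (T : Set Λ)
    (r : Λ → Λ → Prop) : Prop where
  /-- The strategy is deterministic. -/
  strategy_deterministic : ∀ t ∈ T, ∀ u u', r t u → r t u' → u = u'
  /-- States may be considered up to `equiv`, and decode to terms of the calculus. -/
  equivalence : Equivalence M.equiv
  decode_equiv : ∀ s s', M.equiv s s' → M.decode s = M.decode s'
  decode_mem : ∀ s, M.decode s ∈ T
  /-- Initialization: every term has an encoding, unique up to `equiv`, that decodes to it. -/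
  encodes_exists : ∀ t ∈ T, ∃ s, M.encodes t s
  encodes_unique : ∀ t ∈ T, ∀ s s', M.encodes t s → M.encodes t s' → M.equiv s s'
  initialization : ∀ t ∈ T, ∀ s, M.encodes t s → M.decode s = t
  principal_projection : ∀ s s', M.principal s s' → r (M.decode s) (M.decode s')
  overhead_transparency : ∀ s s', M.overhead s s' → M.decode s = M.decode s'
  /-- Determinism of the transition relation on states up to `equiv`. -/
  determinism : ∀ s₁ s₂ s₁' s₂', M.equiv s₁ s₂ → M.step s₁ s₁' → M.step s₂ s₂' →
    M.equiv s₁' s₂'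
  /-- Halt: final states decode to normal terms. -/
  halt : ∀ s, (¬ ∃ s', M.step s s') → ¬ ∃ u, r (M.decode s) u
  overhead_termination : WellFounded fun s' s => M.overhead s s'

/-- Executions and derivations match step for step: an execution from an encoding of `t` to `s`
with `n` principal transitions gives a derivation of length `n` from `t` to the decoding of `s`,
and every derivation of length `n` from `t` to `u` is obtained so. -/
structure Machine.Matches {Λ : Type} (M : Machine Λ) (T : Set Λ) (r : Λ → Λ → Prop) : Prop where
  exec_to_deriv : ∀ t ∈ T, ∀ s₀, M.encodes t s₀ → ∀ n s, M.Exec n s₀ s →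
    Deriv r n t (M.decode s)
  deriv_to_exec : ∀ t ∈ T, ∀ s₀, M.encodes t s₀ → ∀ n u, Deriv r n t u →
    ∃ s, M.Exec n s₀ s ∧ M.decode s = u

/-- The finest crumbled calculus as a machine: the states are the reachable crumbles (up to
α-equivalence), the principal transitions are `→m1 ∪ →m2`, there are no overhead transitions, the
encoding is the crumbling and the decoding is the read-back. -/
def finestMachine : Machine Term where
  State := {E : Crumble // Reachable E}
  equiv := fun E E' => E.1.Alpha [] E'.1
  principal := fun E E' => StepCr E.1 E'.1
  overhead := fun _ _ => False
  encodes := fun t E => Crumb t E.1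
  decode := fun E => E.1.readBack

end Crumbling

/-!
The finest crumbled calculus implements closed right-to-left call-by-value.

A crumble is a nest of `let`s, and is read back here by an evaluator: `Crumble.sem ρ E` interprets
the free variables of `E` in an environment `ρ` of terms, and an entry `[x ← b]` updates `ρ`. It
agrees with the read-back by substitution (`Crumble.readBack_eq_sem`). In `E₀[z ← x y]Eᵥ` the
v-environment `Eᵥ` becomes an environment of values, so that replacing `x y` by the body of `Eᵥ(x)`
is one β-step on the meaning of `z` (`Env.Unfolds.sem_eq`). This is a step of the strategy because
`E₀` reads back, as a function of `z`, to a right v-context. The latter property of all positions of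
applications, at all depths, is `Crumble.Good`. The translation establishes it (`Translates.good`),
and transitions preserve it, because the copied bodies have it already. With closedness and distinct
domains that are not λ-bound it makes up the invariant `Crumble.Inv` of reachable crumbles.

Both α-equivalence and the passage from `E` to `E{x ← y}` are instances of one notion,
`Crumble.AlphaRel R`: equality up to bound variables, and up to the relation `R` on free variables.
It is monotone in `R` on the free variables, and composes as relations do, so that uniqueness of the
crumbling (`Translates.alphaRel`), determinism (`Crumble.Unfolds.alphaRel`) and the invariance of
the read-back and of `Crumble.Good` all follow by following relations on variables.

A closed crumble with an application can make a transition: the variables of its rightmost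
application are in the domain of the environment to its right, and abstractions have variants with
fresh binders (`exists_stepCr`). Without applications it reads back to an abstraction. The step for
step correspondence is then formal (`Machine.IsImplementationSystem.matches`).
-/

namespace Crumbling

/-! ### Simultaneous substitution on terms -/

namespace Term

/-- Raise by one the de Bruijn indices that are at least `k`. -/
def lift : ℕ → Term → Term
  | k, bvar i => if i < k then bvar i else bvar (i + 1)
  | _, fvar x => fvar x
  | k, lam t => lam (lift (k + 1) t)
  | k, app t u => app (lift k t) (lift k u)

/-- Variables in the wide sense: dangling indices and names. -/
def IsVar : Term → Prop
  | bvar _ => True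
  | fvar _ => True
  | _ => False

theorem lift_lift (t : Term) (j k : ℕ) (h : j ≤ k) :
    lift j (lift k t) = lift (k + 1) (lift j t) := by
  induction t generalizing j k with
  | bvar i => simp only [lift]; split_ifs <;> simp only [lift] <;> split_ifs <;> first | rfl | omega
  | fvar x => rfl
  | lam t ih => simp only [lift]; rw [ih _ _ (by omega)]
  | app t u iht ihu => simp only [lift]; rw [iht _ _ h, ihu _ _ h]

theorem lift_inj {t u : Term} (k : ℕ) (h : lift k t = lift k u) : t = u := by
  induction t generalizing k u with
  | bvar i =>
    cases u <;> simp only [lift] at h <;> split_ifs at h <;> simp_all <;> omega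
  | fvar x => cases u <;> simp only [lift] at h <;> first | exact h | (split_ifs at h) | cases h
  | lam t ih =>
    cases u <;> simp only [lift] at h
    · split_ifs at h
    · cases h
    · rw [ih _ (lam.inj h)]
    · cases h
  | app t s iht ihs =>
    cases u <;> simp only [lift] at h
    · split_ifs at h
    · cases h
    · cases h
    · rw [iht _ (app.inj h).1, ihs _ (app.inj h).2]

theorem IsVar.lift {t : Term} (h : t.IsVar) (k : ℕ) : (t.lift k).IsVar := by
  cases t <;> simp only [Term.lift] <;> try split_ifs
  all_goals exact h

theorem lcAt.mono {t : Term} {j k : ℕ} (h : lcAt j t) (hjk : j ≤ k) : lcAt k t := by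
  induction t generalizing j k with
  | bvar i => exact lt_of_lt_of_le h hjk
  | fvar x => trivial
  | lam t ih => exact ih (j := j + 1) h (by omega)
  | app t u iht ihu => exact ⟨iht h.1 hjk, ihu h.2 hjk⟩

theorem lcAt.lift {t : Term} {k : ℕ} (h : lcAt k t) (j : ℕ) : lcAt (k + 1) (t.lift j) := by
  induction t generalizing j k with
  | bvar i =>
    simp only [lcAt] at h
    simp only [Term.lift]; split_ifs <;> simp only [lcAt] <;> omega
  | fvar x => trivial
  | lam t ih => exact ih (k := k + 1) h (j + 1)
  | app t u iht ihu => exact ⟨iht h.1 j, ihu h.2 j⟩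

theorem lcAt.lift_eq {t : Term} {k : ℕ} (h : lcAt k t) : t.lift k = t := by
  induction t generalizing k with
  | bvar i => exact if_pos h
  | fvar x => rfl
  | lam t ih => simp only [Term.lift]; rw [ih h]
  | app t u iht ihu => simp only [Term.lift]; rw [iht h.1, ihu h.2]

theorem lcAt.openAt_eq {t : Term} {k : ℕ} (h : lcAt k t) (u : Term) : openAt u k t = t := by
  induction t generalizing k with
  | bvar i => exact if_neg (ne_of_lt h)
  | fvar x => rfl
  | lam t ih => simp only [openAt]; rw [ih h]
  | app t s iht ihs => simp only [openAt]; rw [iht h.1, ihs h.2]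

theorem lcAt.closeAt {t : Term} {k : ℕ} (h : lcAt k t) (x : Var) :
    lcAt (k + 1) (closeAt x k t) := by
  induction t generalizing k with
  | bvar i => exact Nat.lt_succ_of_lt h
  | fvar y => simp only [Term.closeAt]; split_ifs <;> simp [lcAt]
  | lam t ih => exact ih (k := k + 1) h
  | app t u iht ihu => exact ⟨iht h.1, ihu h.2⟩

theorem lcAt.subst {t u : Term} {k : ℕ} (h : lcAt k t) (x : Var) (hu : lcAt 0 u) :
    lcAt k (subst x u t) := by
  induction t generalizing k with
  | bvar i => exact h
  | fvar y =>
    simp only [Term.subst]; split_ifs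
    · exact hu.mono (Nat.zero_le _)
    · trivial
  | lam t ih => exact ih (k := k + 1) h
  | app t s iht ihs => exact ⟨iht h.1, ihs h.2⟩

theorem lcAt.openAt {t u : Term} {k : ℕ} (h : lcAt (k + 1) t) (hu : lcAt 0 u) :
    lcAt k (openAt u k t) := by
  induction t generalizing k with
  | bvar i =>
    simp only [lcAt] at h
    simp only [Term.openAt]; split_ifs
    · exact hu.mono (Nat.zero_le _)
    · simp only [lcAt]; omega
  | fvar y => trivial
  | lam t ih => exact ih (k := k + 1) h
  | app t s iht ihs => exact ⟨iht h.1, ihs h.2⟩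

theorem openAt_lift {u : Term} (hu : lcAt 0 u) (t : Term) (j k : ℕ) (h : j ≤ k) :
    openAt u (k + 1) (lift j t) = lift j (openAt u k t) := by
  induction t generalizing j k with
  | bvar i =>
    simp only [lift, openAt]
    split_ifs <;> simp only [lift, openAt] <;> split_ifs <;>
      first | rfl | omega | exact ((hu.mono (Nat.zero_le _)).lift_eq).symm
  | fvar x => rfl
  | lam t ih => simp only [lift, openAt]; rw [ih _ _ (by omega)]
  | app t s iht ihs => simp only [lift, openAt]; rw [iht _ _ h, ihs _ _ h]

theorem fv_closeAt (x : Var) (k : ℕ) (t : Term) : fv (closeAt x k t) = fv t \ {x} := by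
  induction t generalizing k with
  | bvar i => simp [closeAt, fv]
  | fvar y =>
    by_cases h : y = x
    · simp [closeAt, fv, h]
    · simp only [closeAt, fv, if_neg h]; ext z; simp; rintro rfl; exact h
  | lam t ih => exact ih _
  | app t u iht ihu => simp only [closeAt, fv, iht, ihu, Finset.union_sdiff_distrib]

theorem fv_abs (x : Var) (t : Term) : fv (abs x t) = fv t \ {x} := fv_closeAt x 0 t

theorem fv_subst (x : Var) (u t : Term) : fv (subst x u t) ⊆ (fv t \ {x}) ∪ fv u := by
  induction t with
  | bvar i => simp [subst, fv]
  | fvar y =>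
    by_cases h : y = x
    · simp [subst, fv, h]
    · simp [subst, fv, h]
  | lam t ih => exact ih
  | app t s iht ihs =>
    intro z hz
    simp only [subst, fv, Finset.mem_union] at hz
    have h1 := @iht z
    have h2 := @ihs z
    simp only [fv, Finset.mem_union, Finset.mem_sdiff] at *
    tauto

theorem closeAt_openAt {x : Var} {t : Term} (h : x ∉ fv t) (k : ℕ) :
    closeAt x k (openAt (fvar x) k t) = t := by
  induction t generalizing k with
  | bvar i =>
    by_cases hi : i = k
    · simp [openAt, closeAt, hi]
    · simp [openAt, closeAt, hi]
  | fvar y =>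
    simp only [fv, Finset.mem_singleton] at h
    simp [openAt, closeAt, Ne.symm h]
  | lam t ih => simp only [openAt, closeAt]; rw [ih h]
  | app t s iht ihs =>
    simp only [fv, Finset.mem_union, not_or] at h
    simp only [openAt, closeAt]; rw [iht h.1, ihs h.2]

theorem fv_openAt_fvar (x : Var) (k : ℕ) (t : Term) :
    fv (openAt (fvar x) k t) ⊆ insert x (fv t) := by
  induction t generalizing k with
  | bvar i => simp only [openAt]; split_ifs <;> simp [fv]
  | fvar y => simp [openAt, fv]
  | lam t ih => exact ih _
  | app t s iht ihs =>
    intro z hz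
    simp only [openAt, fv, Finset.mem_union] at hz
    have h1 := @iht k z
    have h2 := @ihs k z
    simp only [fv, Finset.mem_union, Finset.mem_insert] at *
    tauto

/-- Simultaneous substitution of possibly open terms for all free names; dangling indices of the
substituted terms are raised under abstractions. -/
def msub : (Var → Term) → Term → Term
  | _, bvar i => bvar i
  | ρ, fvar x => ρ x
  | ρ, lam t => lam (msub (fun x => lift 0 (ρ x)) t)
  | ρ, app t u => app (msub ρ t) (msub ρ u)

theorem msub_fvar (t : Term) : msub fvar t = t := by
  induction t with
  | bvar i => rfl
  | fvar x => rfl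
  | lam t ih => exact congrArg lam ih
  | app t u iht ihu => simp only [msub, iht, ihu]

theorem msub_lift {t : Term} {j : ℕ} (h : lcAt j t) (ρ : Var → Term) :
    msub (fun x => lift j (ρ x)) t = lift j (msub ρ t) := by
  induction t generalizing j ρ with
  | bvar i => exact (if_pos h).symm
  | fvar x => rfl
  | lam t ih =>
    simp only [msub, lift]
    rw [← ih (j := j + 1) h]
    simp only [lift_lift _ 0 j (Nat.zero_le _)]
  | app t u iht ihu => simp only [msub, lift, iht h.1, ihu h.2]

/-- The environment `ρ` below a binder of the name `x`, which becomes the index `0`. -/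
def up (ρ : Var → Term) (x : Var) : Var → Term :=
  Function.update (fun y => lift 0 (ρ y)) x (bvar 0)

theorem msub_closeAt (ρ : Var → Term) (x : Var) (k : ℕ) (t : Term) :
    msub ρ (closeAt x k t) = msub (Function.update ρ x (bvar k)) t := by
  induction t generalizing ρ k with
  | bvar i => rfl
  | fvar y =>
    by_cases h : y = x
    · subst h; simp [closeAt, msub]
    · simp [closeAt, msub, h]
  | lam t ih =>
    simp only [closeAt, msub, ih]
    congr 2
    funext y
    by_cases h : y = x
    · subst h; simp [lift]
    · simp [h]
  | app t u iht ihu => simp only [closeAt, msub, iht, ihu]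

theorem msub_abs (ρ : Var → Term) (x : Var) (t : Term) :
    msub ρ (abs x t) = lam (msub (up ρ x) t) := congrArg lam (msub_closeAt _ x 0 t)

theorem msub_subst (ρ : Var → Term) (x : Var) {u : Term} (hu : lcAt 0 u) (t : Term) :
    msub ρ (subst x u t) = msub (Function.update ρ x (msub ρ u)) t := by
  induction t generalizing ρ with
  | bvar i => rfl
  | fvar y =>
    by_cases h : y = x
    · subst h; simp [subst, msub]
    · simp [subst, msub, h]
  | lam t ih =>
    simp only [subst, msub, ih, msub_lift hu]
    congr 2
    funext y
    by_cases h : y = x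
    · subst h; simp
    · simp [h]
  | app t u iht ihu => simp only [subst, msub, iht, ihu]

end Term

open Term

/-! ### Read-back by environments -/

mutual
/-- Read-back of a bite in an environment `ρ` that gives the meaning of its free variables, with
no substitution on terms. -/
def Bite.sem : (Var → Term) → Bite → Term
  | ρ, .app x y => .app (ρ x) (ρ y)
  | ρ, .lamVar x y => .lam (up ρ x y)
  | ρ, .lam x E => .lam (E.sem (up ρ x))
/-- Read-back of a crumble in an environment `ρ`: the entry `[x ← b]` updates `ρ`. -/
def Crumble.sem : (Var → Term) → Crumble → Term
  | ρ, .ret b => b.sem ρ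
  | ρ, .snoc E x b => E.sem (Function.update ρ x (b.sem ρ))
end

mutual
theorem Bite.lcAt_readBack : ∀ b : Bite, lcAt 0 b.readBack
  | .app _ _ => ⟨trivial, trivial⟩
  | .lamVar x y => by
      simp only [Bite.readBack, Term.abs, lcAt]
      exact lcAt.closeAt (k := 0) (t := .fvar y) trivial x
  | .lam x E => by
      simp only [Bite.readBack, Term.abs, lcAt]
      exact (Crumble.lcAt_readBack E).closeAt x
theorem Crumble.lcAt_readBack : ∀ E : Crumble, lcAt 0 E.readBack
  | .ret b => Bite.lcAt_readBack b
  | .snoc E x b => (Crumble.lcAt_readBack E).subst x (Bite.lcAt_readBack b)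
end

mutual
theorem Bite.fv_readBack : ∀ b : Bite, b.readBack.fv ⊆ b.fv
  | .app x y => by intro z; simp [Bite.readBack, Bite.fv, Term.fv]
  | .lamVar x y => by simp [Bite.readBack, Bite.fv, fv_abs, Term.fv]
  | .lam x E => by
      simp only [Bite.readBack, Bite.fv, fv_abs]
      exact Finset.sdiff_subset_sdiff (Crumble.fv_readBack E) (Finset.Subset.refl _)
theorem Crumble.fv_readBack : ∀ E : Crumble, E.readBack.fv ⊆ E.fv
  | .ret b => Bite.fv_readBack b
  | .snoc E x b => by
      simp only [Crumble.readBack, Crumble.fv]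
      exact (fv_subst _ _ _).trans (Finset.union_subset_union
        (Finset.sdiff_subset_sdiff (Crumble.fv_readBack E) (Finset.Subset.refl _))
        (Bite.fv_readBack b))
end

mutual
theorem Bite.msub_readBack : ∀ (b : Bite) (ρ : Var → Term), msub ρ b.readBack = b.sem ρ
  | .app _ _, _ => rfl
  | .lamVar _ _, ρ => by simp only [Bite.readBack, Bite.sem, msub_abs, msub]
  | .lam _ E, ρ => by simp only [Bite.readBack, Bite.sem, msub_abs, Crumble.msub_readBack E]
theorem Crumble.msub_readBack : ∀ (E : Crumble) (ρ : Var → Term), msub ρ E.readBack = E.sem ρ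
  | .ret b, ρ => Bite.msub_readBack b ρ
  | .snoc E x b, ρ => by
      simp only [Crumble.readBack, Crumble.sem, msub_subst ρ x (Bite.lcAt_readBack b),
        Bite.msub_readBack b, Crumble.msub_readBack E]
end

theorem Crumble.readBack_eq_sem (E : Crumble) : E.readBack = E.sem .fvar := by
  rw [← Crumble.msub_readBack, msub_fvar]

mutual
theorem Bite.lcAt_sem : ∀ (b : Bite) {ρ : Var → Term} {k : ℕ}, (∀ x, lcAt k (ρ x)) →
    lcAt k (b.sem ρ)
  | .app _ _, _, _, h => ⟨h _, h _⟩
  | .lamVar _ y, _, _, h => lcAt_up h _ y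
  | .lam _ E, _, _, h => Crumble.lcAt_sem E (lcAt_up h _)
theorem Crumble.lcAt_sem : ∀ (E : Crumble) {ρ : Var → Term} {k : ℕ}, (∀ x, lcAt k (ρ x)) →
    lcAt k (E.sem ρ)
  | .ret b, _, _, h => Bite.lcAt_sem b h
  | .snoc E x b, ρ, k, h => Crumble.lcAt_sem E fun y => by
      by_cases hy : y = x
      · subst hy; simpa using Bite.lcAt_sem b h
      · simpa [hy] using h y
theorem lcAt_up {ρ : Var → Term} {k : ℕ} (h : ∀ x, lcAt k (ρ x)) (x y : Var) :
    lcAt (k + 1) (up ρ x y) := by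
  by_cases hy : y = x
  · subst hy; simp [up, lcAt]
  · simpa [up, hy] using (h y).lift 0
end

theorem openAt_up {u : Term} (hu : lcAt 0 u) (ρ : Var → Term) (k : ℕ) (x : Var) :
    (fun y => openAt u (k + 1) (up ρ x y)) = up (fun y => openAt u k (ρ y)) x := by
  funext y
  by_cases hy : y = x
  · subst hy; simp [up, openAt]
  · simp [up, hy, openAt_lift hu]

mutual
theorem Bite.openAt_sem : ∀ (b : Bite) {u : Term} (_ : lcAt 0 u) (ρ : Var → Term) (k : ℕ),
    openAt u k (b.sem ρ) = b.sem fun x => openAt u k (ρ x)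
  | .app _ _, _, _, _, _ => rfl
  | .lamVar x y, u, hu, ρ, k => congrArg lam (congrFun (openAt_up hu ρ k x) y)
  | .lam x E, u, hu, ρ, k => by
      simp only [Bite.sem, openAt]
      rw [Crumble.openAt_sem E hu, openAt_up hu]
theorem Crumble.openAt_sem : ∀ (E : Crumble) {u : Term} (_ : lcAt 0 u) (ρ : Var → Term) (k : ℕ),
    openAt u k (E.sem ρ) = E.sem fun x => openAt u k (ρ x)
  | .ret b, _, hu, ρ, k => Bite.openAt_sem b hu ρ k
  | .snoc E x b, u, hu, ρ, k => by
      simp only [Crumble.sem]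
      rw [Crumble.openAt_sem E hu, ← Bite.openAt_sem b hu]
      congr 1
      funext y
      by_cases hy : y = x
      · subst hy; simp
      · simp [hy]
end

/-- Contracting a β-redex whose function is a read-back amounts to updating the environment. -/
theorem openAt_up_zero {ρ : Var → Term} (hρ : ∀ x, lcAt 0 (ρ x)) (u : Term) (x : Var) :
    (fun y => openAt u 0 (up ρ x y)) = Function.update ρ x u := by
  funext y
  by_cases hy : y = x
  · subst hy; simp [up, openAt]
  · simp [up, hy, (hρ y).lift_eq, (hρ y).openAt_eq]

/-! ### Correspondence of crumbles along a relation on variables -/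

/-- Extend a relation on variables by a pair of corresponding binders, which shadow. -/
def bindRel (R : Var → Var → Prop) (u w : Var) (x x' : Var) : Prop :=
  (x = u ∧ x' = w) ∨ (x ≠ u ∧ x' ≠ w ∧ R x x')

mutual
/-- The two bites are equal up to their bound variables and up to `R` on their free ones.
For `R = VarAlpha Γ` this is α-equivalence below `Γ`; for `R` the graph of the replacement of a
variable it relates a bite to its instance. -/
inductive Bite.AlphaRel : (Var → Var → Prop) → Bite → Bite → Prop
  | app {R : Var → Var → Prop} {x y x' y' : Var} (hx : R x x') (hy : R y y') :
      Bite.AlphaRel R (.app x y) (.app x' y')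
  | lamVar {R : Var → Var → Prop} {x y x' y' : Var} (h : bindRel R x x' y y') :
      Bite.AlphaRel R (.lamVar x y) (.lamVar x' y')
  | lam {R : Var → Var → Prop} {x x' : Var} {E E' : Crumble}
      (h : Crumble.AlphaRel (bindRel R x x') E E') :
      Bite.AlphaRel R (.lam x E) (.lam x' E')
/-- The two crumbles are equal up to their bound variables and up to `R` on their free ones. -/
inductive Crumble.AlphaRel : (Var → Var → Prop) → Crumble → Crumble → Prop
  | ret {R : Var → Var → Prop} {b b' : Bite} (h : Bite.AlphaRel R b b') :
      Crumble.AlphaRel R (.ret b) (.ret b')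
  | snoc {R : Var → Var → Prop} {E E' : Crumble} {x x' : Var} {b b' : Bite}
      (hE : Crumble.AlphaRel (bindRel R x x') E E') (hb : Bite.AlphaRel R b b') :
      Crumble.AlphaRel R (.snoc E x b) (.snoc E' x' b')
end

mutual
theorem Bite.alphaRel_of_alpha : ∀ (b b' : Bite) (Γ : List (Var × Var)), b.Alpha Γ b' →
    b.AlphaRel (VarAlpha Γ) b'
  | .app _ _, .app _ _, _, h => .app h.1 h.2
  | .lamVar _ _, .lamVar _ _, _, h => .lamVar h
  | .lam _ E, .lam _ E', _, h => .lam (Crumble.alphaRel_of_alpha E E' _ h)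
  | .app _ _, .lamVar _ _, _, h => h.elim
  | .app _ _, .lam _ _, _, h => h.elim
  | .lamVar _ _, .app _ _, _, h => h.elim
  | .lamVar _ _, .lam _ _, _, h => h.elim
  | .lam _ _, .app _ _, _, h => h.elim
  | .lam _ _, .lamVar _ _, _, h => h.elim
theorem Crumble.alphaRel_of_alpha : ∀ (E E' : Crumble) (Γ : List (Var × Var)), E.Alpha Γ E' →
    E.AlphaRel (VarAlpha Γ) E'
  | .ret b, .ret b', Γ, h => .ret (Bite.alphaRel_of_alpha b b' Γ h)
  | .snoc E _ b, .snoc E' _ b', Γ, h =>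
      .snoc (Crumble.alphaRel_of_alpha E E' _ h.2) (Bite.alphaRel_of_alpha b b' Γ h.1)
  | .ret _, .snoc _ _ _, _, h => h.elim
  | .snoc _ _ _, .ret _, _, h => h.elim
end

mutual
theorem Bite.AlphaRel.alpha : ∀ {b b' : Bite} {Γ : List (Var × Var)},
    b.AlphaRel (VarAlpha Γ) b' → b.Alpha Γ b'
  | .app _ _, .app _ _, _, .app hx hy => ⟨hx, hy⟩
  | .lamVar _ _, .lamVar _ _, _, .lamVar h => h
  | .lam x _, .lam x' _, Γ, .lam h => Crumble.AlphaRel.alpha (Γ := (x, x') :: Γ) h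
theorem Crumble.AlphaRel.alpha : ∀ {E E' : Crumble} {Γ : List (Var × Var)},
    E.AlphaRel (VarAlpha Γ) E' → E.Alpha Γ E'
  | .ret _, .ret _, _, .ret h => Bite.AlphaRel.alpha h
  | .snoc _ x _, .snoc _ x' _, Γ, .snoc hE hb =>
      ⟨Bite.AlphaRel.alpha hb, Crumble.AlphaRel.alpha (Γ := (x, x') :: Γ) hE⟩
end

mutual
theorem Bite.AlphaRel.mono : ∀ {b b' : Bite} {R S : Var → Var → Prop}, b.AlphaRel R b' →
    (∀ x x', x ∈ b.fv → x' ∈ b'.fv → R x x' → S x x') → b.AlphaRel S b'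
  | _, _, _, _, .app hx hy, h =>
      .app (h _ _ (by simp [Bite.fv]) (by simp [Bite.fv]) hx)
        (h _ _ (by simp [Bite.fv]) (by simp [Bite.fv]) hy)
  | _, _, _, _, .lamVar hy, h => .lamVar <| hy.imp id fun ⟨h1, h2, h3⟩ =>
      ⟨h1, h2, h _ _ (by simp [Bite.fv, h1]) (by simp [Bite.fv, h2]) h3⟩
  | _, _, _, _, .lam hE, h => .lam <| hE.mono fun _ _ hx hx' hR => hR.imp id fun ⟨h1, h2, h3⟩ =>
      ⟨h1, h2, h _ _ (by simp [Bite.fv, h1, hx]) (by simp [Bite.fv, h2, hx']) h3⟩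
theorem Crumble.AlphaRel.mono : ∀ {E E' : Crumble} {R S : Var → Var → Prop}, E.AlphaRel R E' →
    (∀ x x', x ∈ E.fv → x' ∈ E'.fv → R x x' → S x x') → E.AlphaRel S E'
  | _, _, _, _, .ret hb, h => .ret (hb.mono h)
  | _, _, _, _, .snoc hE hb, h => .snoc
      (hE.mono fun _ _ hx hx' hR => hR.imp id fun ⟨h1, h2, h3⟩ =>
        ⟨h1, h2, h _ _ (by simp [Crumble.fv, h1, hx]) (by simp [Crumble.fv, h2, hx']) h3⟩)
      (hb.mono fun _ _ hx hx' => h _ _ (by simp [Crumble.fv, hx]) (by simp [Crumble.fv, hx']))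
end

theorem bindRel.comp {R S T : Var → Var → Prop} (h : ∀ x y z, R x y → S y z → T x z)
    {u v w x y z : Var} (h1 : bindRel R u v x y) (h2 : bindRel S v w y z) : bindRel T u w x z := by
  rcases h1 with ⟨h1, h1'⟩ | ⟨h1, h1', h1''⟩ <;> rcases h2 with ⟨h2, h2'⟩ | ⟨h2, h2', h2''⟩
  · exact Or.inl ⟨h1, h2'⟩
  · exact (h2 h1').elim
  · exact (h1' h2).elim
  · exact Or.inr ⟨h1, h2', h _ _ _ h1'' h2''⟩

mutual
theorem Bite.AlphaRel.comp : ∀ {b c d : Bite} {R S T : Var → Var → Prop}, b.AlphaRel R c →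
    c.AlphaRel S d → (∀ x y z, R x y → S y z → T x z) → b.AlphaRel T d
  | _, _, _, _, _, _, .app hx hy, .app hx' hy', h => .app (h _ _ _ hx hx') (h _ _ _ hy hy')
  | _, _, _, _, _, _, .lamVar hy, .lamVar hy', h => .lamVar (hy.comp h hy')
  | _, _, _, _, _, _, .lam hE, .lam hE', h => .lam (hE.comp hE' fun _ _ _ => bindRel.comp h)
theorem Crumble.AlphaRel.comp : ∀ {E F G : Crumble} {R S T : Var → Var → Prop}, E.AlphaRel R F →
    F.AlphaRel S G → (∀ x y z, R x y → S y z → T x z) → E.AlphaRel T G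
  | _, _, _, _, _, _, .ret hb, .ret hb', h => .ret (hb.comp hb' h)
  | _, _, _, _, _, _, .snoc hE hb, .snoc hE' hb', h =>
      .snoc (hE.comp hE' fun _ _ _ => bindRel.comp h) (hb.comp hb' h)
end

theorem bindRel.symm {R S : Var → Var → Prop} (h : ∀ x y, R x y → S y x)
    {u w x y : Var} (h1 : bindRel R u w x y) : bindRel S w u y x :=
  h1.imp And.symm fun ⟨h1, h2, h3⟩ => ⟨h2, h1, h _ _ h3⟩

mutual
theorem Bite.AlphaRel.symm : ∀ {b c : Bite} {R S : Var → Var → Prop}, b.AlphaRel R c →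
    (∀ x y, R x y → S y x) → c.AlphaRel S b
  | _, _, _, _, .app hx hy, h => .app (h _ _ hx) (h _ _ hy)
  | _, _, _, _, .lamVar hy, h => .lamVar (hy.symm h)
  | _, _, _, _, .lam hE, h => .lam (hE.symm fun _ _ => bindRel.symm h)
theorem Crumble.AlphaRel.symm : ∀ {E F : Crumble} {R S : Var → Var → Prop}, E.AlphaRel R F →
    (∀ x y, R x y → S y x) → F.AlphaRel S E
  | _, _, _, _, .ret hb, h => .ret (hb.symm h)
  | _, _, _, _, .snoc hE hb, h => .snoc (hE.symm fun _ _ => bindRel.symm h) (hb.symm h)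
end

theorem bindRel.refl {R : Var → Var → Prop} {u x : Var} (h : x ≠ u → R x x) :
    bindRel R u u x x := by
  by_cases hx : x = u
  · exact Or.inl ⟨hx, hx⟩
  · exact Or.inr ⟨hx, hx, h hx⟩

mutual
theorem Bite.AlphaRel.refl : ∀ (b : Bite) {R : Var → Var → Prop}, (∀ x ∈ b.fv, R x x) →
    b.AlphaRel R b
  | .app _ _, _, h => .app (h _ (by simp [Bite.fv])) (h _ (by simp [Bite.fv]))
  | .lamVar _ _, _, h => .lamVar (.refl fun hx => h _ (by simp [Bite.fv, hx]))
  | .lam _ E, _, h => .lam (Crumble.AlphaRel.refl E fun _ hx =>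
      .refl fun hne => h _ (by simp [Bite.fv, hx, hne]))
theorem Crumble.AlphaRel.refl : ∀ (E : Crumble) {R : Var → Var → Prop}, (∀ x ∈ E.fv, R x x) →
    E.AlphaRel R E
  | .ret b, _, h => .ret (Bite.AlphaRel.refl b h)
  | .snoc E _ b, _, h => .snoc
      (Crumble.AlphaRel.refl E fun _ hx => .refl fun hne => h _ (by simp [Crumble.fv, hx, hne]))
      (Bite.AlphaRel.refl b fun _ hx => h _ (by simp [Crumble.fv, hx]))
end

mutual
theorem Bite.AlphaRel.exists_mem_fv : ∀ {b b' : Bite} {R : Var → Var → Prop}, b.AlphaRel R b' →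
    ∀ x' ∈ b'.fv, ∃ x ∈ b.fv, R x x'
  | .app x y, .app x' y', _, .app hx hy, z, hz => by
      simp only [Bite.fv, Finset.mem_insert, Finset.mem_singleton] at hz
      rcases hz with rfl | rfl
      · exact ⟨x, by simp [Bite.fv], hx⟩
      · exact ⟨y, by simp [Bite.fv], hy⟩
  | .lamVar x y, .lamVar x' y', _, .lamVar h, z, hz => by
      simp only [Bite.fv, Finset.mem_sdiff, Finset.mem_singleton] at hz
      obtain ⟨rfl, hz⟩ := hz
      rcases h with h | ⟨h1, h2, h3⟩
      · exact (hz h.2).elim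
      · exact ⟨y, by simp [Bite.fv, h1], h3⟩
  | .lam x E, .lam x' E', _, .lam h, z, hz => by
      simp only [Bite.fv, Finset.mem_sdiff, Finset.mem_singleton] at hz
      obtain ⟨u, hu, hR⟩ := h.exists_mem_fv z hz.1
      rcases hR with hR | ⟨h1, h2, h3⟩
      · exact (hz.2 hR.2).elim
      · exact ⟨u, by simp [Bite.fv, h1, hu], h3⟩
theorem Crumble.AlphaRel.exists_mem_fv : ∀ {E E' : Crumble} {R : Var → Var → Prop},
    E.AlphaRel R E' → ∀ x' ∈ E'.fv, ∃ x ∈ E.fv, R x x'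
  | .ret _, .ret _, _, .ret h, z, hz => h.exists_mem_fv z hz
  | .snoc E x b, .snoc E' x' b', _, .snoc hE hb, z, hz => by
      simp only [Crumble.fv, Finset.mem_union, Finset.mem_sdiff, Finset.mem_singleton] at hz
      rcases hz with hz | hz
      · obtain ⟨u, hu, hR⟩ := hE.exists_mem_fv z hz.1
        rcases hR with hR | ⟨h1, h2, h3⟩
        · exact (hz.2 hR.2).elim
        · exact ⟨u, by simp [Crumble.fv, h1, hu], h3⟩
      · obtain ⟨u, hu, hR⟩ := hb.exists_mem_fv z hz
        exact ⟨u, by simp [Crumble.fv, hu], hR⟩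
end

theorem bindRel.update {α : Type} {R : Var → Var → Prop} {ρ ρ' : Var → α}
    (h : ∀ x x', R x x' → ρ x = ρ' x') (u w : Var) (a : α) (x x' : Var) (hx : bindRel R u w x x') :
    Function.update ρ u a x = Function.update ρ' w a x' := by
  rcases hx with ⟨rfl, rfl⟩ | ⟨h1, h2, h3⟩
  · simp
  · simp [h1, h2, h _ _ h3]

theorem bindRel.up {R : Var → Var → Prop} {ρ ρ' : Var → Term}
    (h : ∀ x x', R x x' → ρ x = ρ' x') (u w : Var) (x x' : Var) (hx : bindRel R u w x x') :
    up ρ u x = up ρ' w x' :=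
  bindRel.update (fun _ _ hR => congrArg (lift 0) (h _ _ hR)) u w _ x x' hx

mutual
theorem Bite.AlphaRel.sem_eq : ∀ {b b' : Bite} {R : Var → Var → Prop} {ρ ρ' : Var → Term},
    b.AlphaRel R b' → (∀ x x', R x x' → ρ x = ρ' x') → b.sem ρ = b'.sem ρ'
  | _, _, _, _, _, .app hx hy, h => by simp only [Bite.sem, h _ _ hx, h _ _ hy]
  | _, _, _, _, _, .lamVar hy, h => congrArg lam (bindRel.up h _ _ _ _ hy)
  | _, _, _, _, _, .lam hE, h => congrArg lam (hE.sem_eq (bindRel.up h _ _))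
theorem Crumble.AlphaRel.sem_eq : ∀ {E E' : Crumble} {R : Var → Var → Prop} {ρ ρ' : Var → Term},
    E.AlphaRel R E' → (∀ x x', R x x' → ρ x = ρ' x') → E.sem ρ = E'.sem ρ'
  | _, _, _, _, _, .ret hb, h => hb.sem_eq h
  | .snoc _ _ _, .snoc _ _ _, _, _, _, .snoc hE hb, h => by
      simp only [Crumble.sem]
      rw [hb.sem_eq h]
      exact hE.sem_eq (bindRel.update h _ _ _)
end

theorem Bite.sem_congr (b : Bite) {ρ ρ' : Var → Term} (h : ∀ x ∈ b.fv, ρ x = ρ' x) :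
    b.sem ρ = b.sem ρ' :=
  (Bite.AlphaRel.refl b (R := fun x x' => ρ x = ρ' x') h).sem_eq fun _ _ => id

theorem Crumble.sem_congr (E : Crumble) {ρ ρ' : Var → Term} (h : ∀ x ∈ E.fv, ρ x = ρ' x) :
    E.sem ρ = E.sem ρ' :=
  (Crumble.AlphaRel.refl E (R := fun x x' => ρ x = ρ' x') h).sem_eq fun _ _ => id

theorem bindRel.subst {x y u z : Var} {R : Var → Var → Prop} (hz : z ≠ y)
    (h : ∀ u, R u (if u = x then y else u)) (hzx : z ≠ x) :
    bindRel R z z u (if u = x then y else u) := by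
  by_cases hu : u = z
  · subst hu; exact Or.inl ⟨rfl, if_neg hzx⟩
  · refine Or.inr ⟨hu, ?_, h u⟩
    split_ifs
    · exact hz.symm
    · exact hu

theorem bindRel.self {x y u : Var} {R : Var → Var → Prop}
    (h : ∀ u, R u (if u = x then y else u)) : bindRel R x x u u :=
  .refl fun hne => by simpa [hne] using h u

mutual
/-- A bite corresponds to its instance `b{x ← y}`, provided that `y` is not captured. -/
theorem Bite.alphaRel_subst : ∀ (b : Bite) {x y : Var} {R : Var → Var → Prop},
    y ∉ b.bv → y ∉ b.allDom → (∀ u, R u (if u = x then y else u)) → b.AlphaRel R (b.subst x y)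
  | .app _ _, _, _, _, _, _, h => .app (h _) (h _)
  | .lamVar z w, x, y, R, hb, _, h => by
      simp only [Bite.bv, Finset.mem_singleton] at hb
      simp only [Bite.subst]
      split_ifs with hz hw
      · subst hz; exact .lamVar (.self h)
      · subst hw; exact .lamVar (by simpa using bindRel.subst (u := w) (Ne.symm hb) h hz)
      · exact .lamVar (by simpa [hw] using bindRel.subst (u := w) (Ne.symm hb) h hz)
  | .lam z E, x, y, R, hb, hd, h => by
      simp only [Bite.bv, Finset.mem_insert, not_or] at hb
      simp only [Bite.allDom] at hd
      simp only [Bite.subst]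
      split_ifs with hz
      · subst hz; exact .lam (Crumble.AlphaRel.refl E fun _ _ => .self h)
      · exact .lam (Crumble.alphaRel_subst E hb.2 hd fun _ => bindRel.subst (Ne.symm hb.1) h hz)
/-- A crumble corresponds to its instance `E{x ← y}`, provided that `y` is not captured. -/
theorem Crumble.alphaRel_subst : ∀ (E : Crumble) {x y : Var} {R : Var → Var → Prop},
    y ∉ E.bv → y ∉ E.allDom → (∀ u, R u (if u = x then y else u)) → E.AlphaRel R (E.subst x y)
  | .ret b, _, _, _, hb, hd, h => .ret (Bite.alphaRel_subst b hb hd h)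
  | .snoc E z b, x, y, R, hb, hd, h => by
      simp only [Crumble.bv, Finset.mem_union, not_or] at hb
      simp only [Crumble.allDom, List.mem_cons, List.mem_append, not_or] at hd
      simp only [Crumble.subst]
      refine .snoc ?_ (Bite.alphaRel_subst b hb.2 hd.2.2 h)
      split_ifs with hz
      · subst hz; exact Crumble.AlphaRel.refl E fun _ _ => .self h
      · exact Crumble.alphaRel_subst E hb.1 hd.2.1 fun _ => bindRel.subst (Ne.symm hd.1) h hz
end

mutual
/-- Every bite has variants whose binders are globally fresh. -/
theorem Bite.exists_fresh : ∀ (b : Bite) {R : Var → Var → Prop} (S : Finset Var),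
    (∀ x ∈ b.fv, ∃ x' ∈ S, R x x') →
    ∃ b' : Bite, b.AlphaRel R b' ∧ b'.allDom.Nodup ∧ (∀ z ∈ b'.allDom, z ∉ S ∧ z ∉ b'.bv) ∧
      ∀ z ∈ b'.bv, z ∉ S
  | .app x y, R, S, h => by
      obtain ⟨x', -, hx⟩ := h x (by simp [Bite.fv])
      obtain ⟨y', -, hy⟩ := h y (by simp [Bite.fv])
      exact ⟨.app x' y', .app hx hy, by simp [Bite.allDom, Bite.bv]⟩
  | .lamVar x y, R, S, h => by
      obtain ⟨x', hx'⟩ := Infinite.exists_notMem_finset S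
      by_cases hxy : y = x
      · exact ⟨.lamVar x' x', .lamVar (Or.inl ⟨hxy, rfl⟩), by simpa [Bite.allDom, Bite.bv]⟩
      · obtain ⟨y', hy', hy⟩ := h y (by simp [Bite.fv, hxy])
        exact ⟨.lamVar x' y', .lamVar (Or.inr ⟨hxy, fun e => hx' (e ▸ hy'), hy⟩),
          by simpa [Bite.allDom, Bite.bv]⟩
  | .lam x E, R, S, h => by
      obtain ⟨x', hx'⟩ := Infinite.exists_notMem_finset S
      obtain ⟨E', hE', hn, hd, hb⟩ := Crumble.exists_fresh E (R := bindRel R x x') (insert x' S) (by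
        intro u hu
        by_cases hux : u = x
        · exact ⟨x', by simp, Or.inl ⟨hux, rfl⟩⟩
        · obtain ⟨u', hu', hR⟩ := h u (by simp [Bite.fv, hux, hu])
          exact ⟨u', by simp [hu'], Or.inr ⟨hux, fun e => hx' (e ▸ hu'), hR⟩⟩)
      refine ⟨.lam x' E', .lam hE', hn, fun z hz => ?_, fun z hz => ?_⟩
      · have := hd z hz
        simp only [Finset.mem_insert, not_or] at this
        simp only [Bite.bv, Finset.mem_insert, not_or]
        tauto
      · simp only [Bite.bv, Finset.mem_insert] at hz
        rcases hz with rfl | hz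
        · exact hx'
        · exact fun h' => hb z hz (by simp [h'])
/-- Every crumble has variants whose binders are globally fresh. -/
theorem Crumble.exists_fresh : ∀ (E : Crumble) {R : Var → Var → Prop} (S : Finset Var),
    (∀ x ∈ E.fv, ∃ x' ∈ S, R x x') →
    ∃ E' : Crumble, E.AlphaRel R E' ∧ E'.allDom.Nodup ∧ (∀ z ∈ E'.allDom, z ∉ S ∧ z ∉ E'.bv) ∧
      ∀ z ∈ E'.bv, z ∉ S
  | .ret b, R, S, h => by
      obtain ⟨b', hb', h'⟩ := Bite.exists_fresh b S h
      exact ⟨.ret b', .ret hb', h'⟩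
  | .snoc E x b, R, S, h => by
      obtain ⟨b', hb', hbn, hbd, hbb⟩ := Bite.exists_fresh b (R := R) S
        fun u hu => h u (by simp [Crumble.fv, hu])
      obtain ⟨x', hx'⟩ := Infinite.exists_notMem_finset (S ∪ b'.allDom.toFinset ∪ b'.bv)
      simp only [Finset.mem_union, List.mem_toFinset, not_or] at hx'
      obtain ⟨E', hE', hn, hd, hb⟩ := Crumble.exists_fresh E (R := bindRel R x x')
        (insert x' (S ∪ b'.allDom.toFinset ∪ b'.bv)) (by
          intro u hu
          by_cases hux : u = x
          · exact ⟨x', by simp, Or.inl ⟨hux, rfl⟩⟩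
          · obtain ⟨u', hu', hR⟩ := h u (by simp [Crumble.fv, hux, hu])
            exact ⟨u', by simp [hu'], Or.inr ⟨hux, fun e => hx'.1.1 (e ▸ hu'), hR⟩⟩)
      simp only [Finset.mem_insert, Finset.mem_union, List.mem_toFinset, not_or] at hd hb
      refine ⟨.snoc E' x' b', .snoc hE' hb', ?_, ?_, ?_⟩
      · simp only [Crumble.allDom, List.nodup_cons, List.mem_append, not_or, List.nodup_append']
        exact ⟨⟨fun h => (hd _ h).1.1 rfl, hx'.1.2⟩, hn, hbn,
          fun z hz hz' => (hd z hz).1.2.1.2 hz'⟩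
      · intro z hz
        simp only [Crumble.allDom, List.mem_cons, List.mem_append] at hz
        simp only [Crumble.bv, Finset.mem_union, not_or]
        rcases hz with rfl | hz | hz
        · exact ⟨hx'.1.1, fun h => (hb _ h).1 rfl, hx'.2⟩
        · exact ⟨(hd z hz).1.2.1.1, (hd z hz).2, (hd z hz).1.2.2⟩
        · exact ⟨(hbd z hz).1, fun h => (hb z h).2.1.2 hz, (hbd z hz).2⟩
      · intro z hz
        simp only [Crumble.bv, Finset.mem_union] at hz
        rcases hz with hz | hz
        · exact (hb z hz).2.1.1
        · exact hbb z hz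
end

/-! ### Contexts and concatenation -/

/-- Free variables of an environment context. -/
def ECtx.fv : ECtx → Finset Var
  | ret => ∅
  | snoc E z => E.fv \ {z}

/-- The domain of an environment context. -/
def ECtx.dom : ECtx → List Var
  | ret => []
  | snoc E z => z :: E.dom

/-- The λ-bound variables of an environment context. -/
def ECtx.bv : ECtx → Finset Var
  | ret => ∅
  | snoc E _ => E.bv

/-- Read-back of an environment context whose hole reads back to `s`. -/
def ECtx.sem : ECtx → (Var → Term) → Term → Term
  | ret, _, s => s
  | snoc E z, ρ, s => E.sem (Function.update ρ z s)

/-- Environment contexts that are equal up to their bound variables and up to `R`. -/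
inductive ECtx.AlphaRel (R : Var → Var → Prop) : ECtx → ECtx → Prop
  | ret : ECtx.AlphaRel R .ret .ret
  | snoc {E E' : Crumble} {z z' : Var} (h : E.AlphaRel (bindRel R z z') E') :
      ECtx.AlphaRel R (.snoc E z) (.snoc E' z')

theorem ECtx.fv_plug (C : ECtx) (b : Bite) : (C.plug b).fv = C.fv ∪ b.fv := by
  cases C <;> simp [ECtx.plug, Crumble.fv, ECtx.fv]

theorem ECtx.fv_plugCrumble (C : ECtx) : ∀ E : Crumble, (C.plugCrumble E).fv ⊆ C.fv ∪ E.fv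
  | .ret b => (C.fv_plug b).le
  | .snoc E x b => by
      intro z hz
      have := @ECtx.fv_plugCrumble C E z
      simp only [ECtx.plugCrumble, Crumble.fv, Finset.mem_union, Finset.mem_sdiff,
        Finset.mem_singleton] at *
      tauto

theorem ECtx.dom_plug (C : ECtx) (b : Bite) : (C.plug b).dom = C.dom := by
  cases C <;> rfl

theorem ECtx.dom_plugCrumble (C : ECtx) : ∀ E : Crumble, (C.plugCrumble E).dom = E.dom ++ C.dom
  | .ret b => C.dom_plug b
  | .snoc E x _ => congrArg (x :: ·) (ECtx.dom_plugCrumble C E)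

theorem ECtx.bv_plug (C : ECtx) (b : Bite) : (C.plug b).bv = C.bv ∪ b.bv := by
  cases C <;> simp [ECtx.plug, Crumble.bv, ECtx.bv]

theorem ECtx.bv_plugCrumble (C : ECtx) : ∀ E : Crumble, (C.plugCrumble E).bv = C.bv ∪ E.bv
  | .ret b => C.bv_plug b
  | .snoc E x b => by
      simp only [ECtx.plugCrumble, Crumble.bv, ECtx.bv_plugCrumble C E, Finset.union_assoc]

theorem ECtx.allDom_plugCrumble (E₀ : Crumble) (z : Var) : ∀ E : Crumble,
    ((ECtx.snoc E₀ z).plugCrumble E).allDom.Perm (z :: (E₀.allDom ++ E.allDom))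
  | .ret _ => .refl _
  | .snoc E x b => by
      have ih := ECtx.allDom_plugCrumble E₀ z E
      simp only [ECtx.plugCrumble, Crumble.allDom]
      refine ((ih.append_right _).cons x).trans ?_
      simp only [List.cons_append]
      refine (List.Perm.swap z x _).trans (List.Perm.cons z ?_)
      rw [List.append_assoc]
      exact List.perm_middle.symm

theorem ECtx.sem_plug (C : ECtx) (b : Bite) (ρ : Var → Term) :
    (C.plug b).sem ρ = C.sem ρ (b.sem ρ) := by
  cases C <;> rfl

theorem ECtx.sem_congr (C : ECtx) {ρ ρ' : Var → Term} (h : ∀ x ∈ C.fv, ρ x = ρ' x) (s : Term) :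
    C.sem ρ s = C.sem ρ' s := by
  cases C with
  | ret => rfl
  | snoc E z =>
    refine E.sem_congr fun x hx => ?_
    by_cases hxz : x = z
    · subst hxz; simp
    · simpa [hxz] using h x (by simp [ECtx.fv, hx, hxz])

theorem ECtx.sem_update (C : ECtx) (ρ : Var → Term) {w : Var} (hw : w ∉ C.fv) (r s : Term) :
    C.sem (Function.update ρ w r) s = C.sem ρ s :=
  C.sem_congr (fun x hx => Function.update_of_ne (fun e : x = w => hw (e ▸ hx)) _ _) s

theorem ECtx.sem_plugCrumble (C : ECtx) : ∀ (E : Crumble) (ρ : Var → Term),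
    (∀ w ∈ E.dom, w ∉ C.fv) → (C.plugCrumble E).sem ρ = C.sem ρ (E.sem ρ)
  | .ret b, ρ, _ => C.sem_plug b ρ
  | .snoc E x b, ρ, h => by
      simp only [Crumble.dom, List.mem_cons, forall_eq_or_imp] at h
      simp only [ECtx.plugCrumble, Crumble.sem]
      rw [ECtx.sem_plugCrumble C E _ h.2, C.sem_update ρ h.1]

theorem ECtx.AlphaRel.plug {R : Var → Var → Prop} {C C' : ECtx} {b b' : Bite}
    (hC : C.AlphaRel R C') (hb : b.AlphaRel R b') : (C.plug b).AlphaRel R (C'.plug b') := by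
  cases hC with
  | ret => exact .ret hb
  | snoc h => exact .snoc h hb

theorem ECtx.AlphaRel.of_plug {R : Var → Var → Prop} {C C' : ECtx} {b b' : Bite}
    (h : (C.plug b).AlphaRel R (C'.plug b')) : C.AlphaRel R C' ∧ b.AlphaRel R b' := by
  cases C <;> cases C' <;> simp only [ECtx.plug] at h <;> cases h
  · exact ⟨.ret, by assumption⟩
  · exact ⟨.snoc (by assumption), by assumption⟩

theorem ECtx.AlphaRel.mono {R S : Var → Var → Prop} {C C' : ECtx} (hC : C.AlphaRel R C')
    (h : ∀ x x', x ∈ C.fv → x' ∈ C'.fv → R x x' → S x x') : C.AlphaRel S C' := by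
  cases hC with
  | ret => exact .ret
  | snoc hE =>
    exact .snoc (hE.mono fun x x' hx hx' hR => hR.imp id fun ⟨h1, h2, h3⟩ =>
      ⟨h1, h2, h _ _ (by simp [ECtx.fv, h1, hx]) (by simp [ECtx.fv, h2, hx']) h3⟩)

theorem ECtx.AlphaRel.plugCrumble : ∀ {E E' : Crumble} {R : Var → Var → Prop} {C C' : ECtx},
    C.AlphaRel R C' → E.AlphaRel R E' → (∀ w ∈ E.dom, w ∉ C.fv) → (∀ w ∈ E'.dom, w ∉ C'.fv) →
    (C.plugCrumble E).AlphaRel R (C'.plugCrumble E')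
  | _, _, _, _, _, hC, .ret hb, _, _ => hC.plug hb
  | _, _, _, C, C', hC, .snoc (x := x) (x' := x') hE hb, h, h' => by
      simp only [Crumble.dom, List.mem_cons, forall_eq_or_imp] at h h'
      refine .snoc (ECtx.AlphaRel.plugCrumble (hC.mono fun u u' hu hu' hR => ?_) hE h.2 h'.2) hb
      exact Or.inr ⟨fun e => h.1 (e ▸ hu), fun e => h'.1 (e ▸ hu'), hR⟩

/-! ### Right contexts -/

/-- Composition of right v-contexts. -/
def RCtx.comp : RCtx → RCtx → RCtx
  | hole, R' => R'
  | appR t R, R' => appR t (R.comp R')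
  | appL R v hv, R' => appL (R.comp R') v hv

theorem RCtx.plug_comp (R R' : RCtx) (s : Term) : (R.comp R').plug s = R.plug (R'.plug s) := by
  induction R with
  | hole => rfl
  | appR t R ih => simp only [comp, plug, ih]
  | appL R v hv ih => simp only [comp, plug, ih]

/-- The context reads back to a right v-context in every environment of values. -/
def ECtx.IsRight (C : ECtx) : Prop :=
  ∀ ρ : Var → Term, (∀ x, (ρ x).IsValue) → ∃ R : RCtx, ∀ s, C.sem ρ s = R.plug s

mutual
/-- All crumbles in the bite, at all depths, have only right contexts around their applications. -/
def Bite.Good : Bite → Prop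
  | .app _ _ => True
  | .lamVar _ _ => True
  | .lam _ E => E.Good
/-- The crumble, and all bodies inside it, read back to right v-contexts when they are cut at an
application. -/
def Crumble.Good : Crumble → Prop
  | .ret b => b.Good
  | .snoc E x b => E.Good ∧ b.Good ∧ (¬ b.IsValue → (ECtx.snoc E x).IsRight)
end

/-- The crumble of an environment context is good. -/
def ECtx.Good : ECtx → Prop
  | ret => True
  | snoc E _ => E.Good

theorem ECtx.isRight_ret : ECtx.ret.IsRight := fun _ _ => ⟨.hole, fun _ => rfl⟩

theorem ECtx.good_plug {C : ECtx} {b : Bite} :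
    (C.plug b).Good ↔ C.Good ∧ b.Good ∧ (¬ b.IsValue → C.IsRight) := by
  cases C with
  | ret => simp [ECtx.plug, Crumble.Good, ECtx.Good, ECtx.isRight_ret]
  | snoc E z => simp [ECtx.plug, Crumble.Good, ECtx.Good]

theorem ECtx.good_plugCrumble {C : ECtx} (hC : C.Good) (hR : C.IsRight) : ∀ {E : Crumble},
    E.Good → (∀ w ∈ E.dom, w ∉ C.fv) → (C.plugCrumble E).Good
  | .ret _, hE, _ => ECtx.good_plug.2 ⟨hC, hE, fun _ => hR⟩
  | .snoc E x b, hE, h => by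
      simp only [Crumble.dom, List.mem_cons, forall_eq_or_imp] at h
      refine ⟨ECtx.good_plugCrumble hC hR hE.1 h.2, hE.2.1, fun hb ρ hρ => ?_⟩
      obtain ⟨R, hRC⟩ := hR ρ hρ
      obtain ⟨R', hRE⟩ := hE.2.2 hb ρ hρ
      refine ⟨R.comp R', fun s => ?_⟩
      simp only [ECtx.sem] at hRE ⊢
      rw [C.sem_plugCrumble E _ h.2, C.sem_update ρ h.1, hRC, RCtx.plug_comp, hRE]

theorem Bite.AlphaRel.isValue {b b' : Bite} {R : Var → Var → Prop} (h : b.AlphaRel R b') :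
    b.IsValue ↔ b'.IsValue := by
  cases h <;> exact Iff.rfl

theorem bindRel.functional {R : Var → Var → Prop} (hR : ∀ x y z, R x y → R x z → y = z)
    (u w x y z : Var) (h1 : bindRel R u w x y) (h2 : bindRel R u w x z) : y = z := by
  rcases h1 with ⟨h1, h1'⟩ | ⟨h1, h1', h1''⟩ <;> rcases h2 with ⟨h2, h2'⟩ | ⟨h2, h2', h2''⟩
  · exact h1'.trans h2'.symm
  · exact (h2 h1).elim
  · exact (h1 h2).elim
  · exact hR _ _ _ h1'' h2''

theorem ECtx.AlphaRel.sem_eq {C C' : ECtx} {R : Var → Var → Prop} {ρ ρ' : Var → Term}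
    (hC : C.AlphaRel R C') (h : ∀ x x', R x x' → ρ x = ρ' x') (s : Term) :
    C.sem ρ s = C'.sem ρ' s := by
  cases hC with
  | ret => rfl
  | snoc hE => exact hE.sem_eq (bindRel.update h _ _ _)

/-- Right contexts are stable under α-equivalence and under replacing a variable by another, which
are functional relations. -/
theorem ECtx.AlphaRel.isRight {C C' : ECtx} {R : Var → Var → Prop} (hC : C.AlphaRel R C')
    (hR : ∀ x y z, R x y → R x z → y = z) (h : C.IsRight) : C'.IsRight := by
  classical
  intro ρ' hρ'
  -- An environment for `C` is read off from `ρ'` along the functional relation `R`; variables that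
  -- have no counterpart may be given any value.
  have key : ∀ x, ∃ v : Term, v.IsValue ∧ ∀ x', R x x' → v = ρ' x' := fun x => by
    by_cases hx : ∃ x', R x x'
    · obtain ⟨x', hx'⟩ := hx
      exact ⟨ρ' x', hρ' x', fun y hy => congrArg ρ' (hR _ _ _ hx' hy)⟩
    · exact ⟨.fvar 0, trivial, fun y hy => (hx ⟨y, hy⟩).elim⟩
  choose ρ hρ hρR using key
  obtain ⟨K, hK⟩ := h ρ hρ
  exact ⟨K, fun s => (hC.sem_eq hρR s).symm.trans (hK s)⟩

mutual
theorem Bite.AlphaRel.good : ∀ {b b' : Bite} {R : Var → Var → Prop}, b.AlphaRel R b' →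
    (∀ x y z, R x y → R x z → y = z) → b.Good → b'.Good
  | _, _, _, .app _ _, _, _ => trivial
  | _, _, _, .lamVar _, _, _ => trivial
  | _, _, _, .lam hE, hR, h => hE.good (bindRel.functional hR _ _) h
theorem Crumble.AlphaRel.good : ∀ {E E' : Crumble} {R : Var → Var → Prop}, E.AlphaRel R E' →
    (∀ x y z, R x y → R x z → y = z) → E.Good → E'.Good
  | _, _, _, .ret hb, hR, h => hb.good hR h
  | _, _, _, .snoc hE hb, hR, h =>
      ⟨hE.good (bindRel.functional hR _ _) h.1, hb.good hR h.2.1, fun hv =>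
        (ECtx.AlphaRel.snoc hE).isRight hR (h.2.2 (mt hb.isValue.1 hv))⟩
end

/-! ### The crumbling translation -/

/-- The variables in the domains of a crumble, at all depths, are pairwise distinct, not in `S`
and not λ-bound. -/
def Crumble.Fresh (S : Finset Var) (E : Crumble) : Prop :=
  E.allDom.Nodup ∧ ∀ z ∈ E.allDom, z ∉ S ∧ z ∉ E.bv

theorem Crumble.Fresh.anti {S T : Finset Var} {E : Crumble} (h : E.Fresh S) (hT : T ⊆ S) :
    E.Fresh T :=
  ⟨h.1, fun z hz => ⟨fun hzT => (h.2 z hz).1 (hT hzT), (h.2 z hz).2⟩⟩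

theorem Crumble.dom_subset_allDom : ∀ (E : Crumble), E.dom ⊆ E.allDom
  | .ret _ => by simp [Crumble.dom]
  | .snoc E x b => by
      intro z hz
      simp only [Crumble.dom, List.mem_cons] at hz
      simp only [Crumble.allDom, List.mem_cons, List.mem_append]
      exact hz.imp id fun h => Or.inl (Crumble.dom_subset_allDom E h)

theorem Crumble.fresh_plugCrumble {S : Finset Var} {E₀ E : Crumble} {z : Var} :
    ((ECtx.snoc E₀ z).plugCrumble E).Fresh S ↔
      (z ∉ S ∧ z ∉ E₀.allDom ∧ z ∉ E.allDom ∧ z ∉ E₀.bv ∧ z ∉ E.bv) ∧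
      E₀.Fresh S ∧ E.Fresh S ∧ (∀ w ∈ E₀.allDom, w ∉ E.allDom ∧ w ∉ E.bv) ∧
      ∀ w ∈ E.allDom, w ∉ E₀.bv := by
  have hp := ECtx.allDom_plugCrumble E₀ z E
  simp only [Crumble.Fresh, hp.nodup_iff, hp.mem_iff, ECtx.bv_plugCrumble, ECtx.bv,
    List.nodup_cons, List.nodup_append', List.mem_cons, List.mem_append, Finset.mem_union, not_or,
    List.disjoint_left]
  constructor
  · rintro ⟨⟨⟨h1, h2⟩, h3, h4, h5⟩, h6⟩
    have hz := h6 z (Or.inl rfl)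
    exact ⟨⟨hz.1, h1, h2, hz.2⟩, ⟨h3, fun w hw => ⟨(h6 w (by simp [hw])).1, (h6 w (by simp [hw])).2.1⟩⟩,
      ⟨h4, fun w hw => ⟨(h6 w (by simp [hw])).1, (h6 w (by simp [hw])).2.2⟩⟩,
      fun w hw => ⟨h5 hw, (h6 w (by simp [hw])).2.2⟩, fun w hw => (h6 w (by simp [hw])).2.1⟩
  · rintro ⟨⟨h1, h2, h3, h4, h5⟩, ⟨h6, h7⟩, ⟨h8, h9⟩, h10, h11⟩
    refine ⟨⟨⟨h2, h3⟩, h6, h8, fun _ hw => (h10 _ hw).1⟩, ?_⟩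
    rintro w (rfl | hw | hw)
    · exact ⟨h1, h4, h5⟩
    · exact ⟨(h7 w hw).1, (h7 w hw).2, (h10 w hw).2⟩
    · exact ⟨(h9 w hw).1, h11 w hw, (h9 w hw).2⟩

theorem Translates.not_isVar_msub {t : Term} {E : Crumble} (h : Translates t E)
    (ρ : Var → Term) : ¬ (msub ρ t).IsVar := by
  cases h <;> exact id

theorem Translates.fv_subset {t : Term} {E : Crumble} (h : Translates t E) : E.fv ⊆ t.fv := by
  induction h with
  | appVarVar x y => exact Finset.Subset.refl _
  | lamVar x y => rw [fv_abs]; exact Finset.Subset.refl _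
  | lam x t E _ ih => rw [fv_abs]; exact Finset.sdiff_subset_sdiff ih (Finset.Subset.refl _)
  | appVar u E x y _ ih =>
    intro z hz
    have h1 := ECtx.fv_plugCrumble _ _ hz
    have h2 := @ih z
    simp only [ECtx.fv, Crumble.fv, Bite.fv, Term.fv, Finset.mem_union, Finset.mem_sdiff,
      Finset.mem_insert, Finset.mem_singleton] at *
    tauto
  | varApp u E x y _ ih =>
    intro z hz
    have h1 := ECtx.fv_plugCrumble _ _ hz
    have h2 := @ih z
    simp only [ECtx.fv, Crumble.fv, Bite.fv, Term.fv, Finset.mem_union, Finset.mem_sdiff,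
      Finset.mem_insert, Finset.mem_singleton] at *
    tauto
  | app u u' E E' x y _ _ ih ih' =>
    intro z hz
    have h1 := ECtx.fv_plugCrumble _ _ hz
    simp only [ECtx.fv, Finset.mem_union, Finset.mem_sdiff] at h1
    have h2 := @ih z
    have h2' := @ih' z
    have h3 := @ECtx.fv_plugCrumble (ECtx.snoc (.ret (.app x y)) x) E z
    simp only [ECtx.fv, Crumble.fv, Bite.fv, Term.fv, Finset.mem_union, Finset.mem_sdiff,
      Finset.mem_insert, Finset.mem_singleton] at *
    tauto

/-- The freshness conditions on the crumbling of `u y`, for `u` not a variable. -/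
theorem Crumble.Fresh.appVar {u : Term} {E : Crumble} {x y : Var}
    (h : ((ECtx.snoc (.ret (.app x y)) x).plugCrumble E).Fresh (Term.app u (.fvar y)).fv) :
    x ≠ y ∧ E.Fresh u.fv ∧ ∀ w ∈ E.dom, w ∉ (ECtx.snoc (.ret (.app x y)) x).fv := by
  obtain ⟨⟨h1, -⟩, -, h2, -⟩ := Crumble.fresh_plugCrumble.1 h
  refine ⟨fun e => h1 (by simp [Term.fv, e]), h2.anti (by simp [Term.fv]), fun w hw hw' => ?_⟩
  have := (h2.2 w (E.dom_subset_allDom hw)).1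
  simp only [ECtx.fv, Crumble.fv, Bite.fv, Term.fv, Finset.mem_sdiff, Finset.mem_union,
    Finset.mem_insert, Finset.mem_singleton] at *
  tauto

/-- The freshness conditions on the crumbling of `x u`, for `u` not a variable. -/
theorem Crumble.Fresh.varApp {u : Term} {E : Crumble} {x y : Var}
    (h : ((ECtx.snoc (.ret (.app x y)) y).plugCrumble E).Fresh (Term.app (.fvar x) u).fv) :
    x ≠ y ∧ E.Fresh u.fv ∧ ∀ w ∈ E.dom, w ∉ (ECtx.snoc (.ret (.app x y)) y).fv := by
  obtain ⟨⟨h1, -⟩, -, h2, -⟩ := Crumble.fresh_plugCrumble.1 h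
  refine ⟨fun e => h1 (by simp [Term.fv, e]), h2.anti (by simp [Term.fv]), fun w hw hw' => ?_⟩
  have := (h2.2 w (E.dom_subset_allDom hw)).1
  simp only [ECtx.fv, Crumble.fv, Bite.fv, Term.fv, Finset.mem_sdiff, Finset.mem_union,
    Finset.mem_insert, Finset.mem_singleton] at *
  tauto

/-- The freshness conditions on the crumbling of `u u'`, for `u` and `u'` not variables. -/
theorem Crumble.Fresh.app {u u' : Term} {E E' : Crumble} {x y : Var} (hu : E.fv ⊆ u.fv)
    (h : ((ECtx.snoc ((ECtx.snoc (.ret (.app x y)) x).plugCrumble E) y).plugCrumble E').Fresh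
      (Term.app u u').fv) :
    x ≠ y ∧ y ∉ E.fv ∧ E.Fresh u.fv ∧ E'.Fresh u'.fv ∧
      (∀ w ∈ E.dom, w ∉ (ECtx.snoc (.ret (.app x y)) x).fv) ∧
      ∀ w ∈ E'.dom, w ∉ (ECtx.snoc ((ECtx.snoc (.ret (.app x y)) x).plugCrumble E) y).fv := by
  obtain ⟨⟨hy, hy', -⟩, h1, h2, -⟩ := Crumble.fresh_plugCrumble.1 h
  obtain ⟨-, -, h3, -⟩ := Crumble.fresh_plugCrumble.1 h1
  have hp := fun w => (ECtx.allDom_plugCrumble (.ret (.app x y)) x E).mem_iff (a := w)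
  simp only [List.mem_cons, Crumble.allDom, Bite.allDom, List.nil_append] at hp
  simp only [hp, not_or] at hy'
  refine ⟨Ne.symm hy'.1, fun e => hy (by simp [Term.fv, hu e]), h3.anti (by simp [Term.fv]),
    h2.anti (by simp [Term.fv]), fun w hw hw' => ?_, fun w hw hw' => ?_⟩
  · have hw := E.dom_subset_allDom hw
    simp only [ECtx.fv, Crumble.fv, Bite.fv, Finset.mem_sdiff, Finset.mem_insert,
      Finset.mem_singleton] at hw'
    rcases hw' with ⟨rfl | rfl, h'⟩
    · exact h' rfl
    · exact hy'.2 hw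
  · have hw := (h2.2 w (E'.dom_subset_allDom hw)).1
    have h4 := @ECtx.fv_plugCrumble (ECtx.snoc (.ret (.app x y)) x) E w
    have h5 := @hu w
    simp only [ECtx.fv, Crumble.fv, Bite.fv, Term.fv, Finset.mem_sdiff, Finset.mem_union,
      Finset.mem_insert, Finset.mem_singleton] at *
    tauto

theorem Crumble.Fresh.lam {t : Term} {E : Crumble} {x : Var}
    (h : (Crumble.ret (.lam x E)).Fresh (Term.abs x t).fv) : E.Fresh t.fv := by
  refine ⟨h.1, fun z hz => ?_⟩
  have := h.2 z hz
  simp only [fv_abs, Crumble.bv, Bite.bv, Finset.mem_sdiff, Finset.mem_insert,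
    Finset.mem_singleton] at this
  tauto

theorem ECtx.sem_appVar {x y : Var} (h : x ≠ y) (ρ : Var → Term) (s : Term) :
    (ECtx.snoc (.ret (.app x y)) x).sem ρ s = .app s (ρ y) := by
  simp [ECtx.sem, Crumble.sem, Bite.sem, h.symm]

theorem ECtx.sem_varApp {x y : Var} (h : x ≠ y) (ρ : Var → Term) (s : Term) :
    (ECtx.snoc (.ret (.app x y)) y).sem ρ s = .app (ρ x) s := by
  simp [ECtx.sem, Crumble.sem, Bite.sem, h]

theorem ECtx.sem_app {E : Crumble} {x y : Var} (h : x ≠ y) (hy : y ∉ E.fv)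
    (hE : ∀ w ∈ E.dom, w ∉ (ECtx.snoc (.ret (.app x y)) x).fv) (ρ : Var → Term) (s : Term) :
    (ECtx.snoc ((ECtx.snoc (.ret (.app x y)) x).plugCrumble E) y).sem ρ s =
      .app (E.sem ρ) s := by
  rw [ECtx.sem, ECtx.sem_plugCrumble _ E _ hE, ECtx.sem_appVar h, Function.update_self]
  congr 1
  exact E.sem_congr fun z hz => Function.update_of_ne (fun e : z = y => hy (e ▸ hz)) _ _

theorem Translates.readBack {t : Term} {E : Crumble} (h : Translates t E) (hf : E.Fresh t.fv) :
    E.readBack = t := by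
  rw [Crumble.readBack_eq_sem]
  induction h with
  | appVarVar x y => rfl
  | lamVar x y => rw [← Crumble.readBack_eq_sem]; rfl
  | lam x t E h ih =>
    rw [← Crumble.readBack_eq_sem]
    simp only [Crumble.readBack, Bite.readBack]
    rw [Crumble.readBack_eq_sem, ih hf.lam]
  | appVar u E x y h ih =>
    obtain ⟨hxy, hE, hd⟩ := hf.appVar
    rw [ECtx.sem_plugCrumble _ E _ hd, ECtx.sem_appVar hxy, ih hE]
  | varApp u E x y h ih =>
    obtain ⟨hxy, hE, hd⟩ := hf.varApp
    rw [ECtx.sem_plugCrumble _ E _ hd, ECtx.sem_varApp hxy, ih hE]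
  | app u u' E E' x y h h' ih ih' =>
    obtain ⟨hxy, hy, hE, hE', hd, hd'⟩ := hf.app h.fv_subset
    rw [ECtx.sem_plugCrumble _ E' _ hd', ECtx.sem_app hxy hy hd, ih hE, ih' hE']

theorem Translates.good {t : Term} {E : Crumble} (h : Translates t E) (hf : E.Fresh t.fv) :
    E.Good := by
  induction h with
  | appVarVar x y => trivial
  | lamVar x y => trivial
  | lam x t E h ih => exact ih hf.lam
  | appVar u E x y h ih =>
    obtain ⟨hxy, hE, hd⟩ := hf.appVar
    refine ECtx.good_plugCrumble (C := .snoc (.ret (.app x y)) x) trivial (fun ρ hρ => ?_) (ih hE) hd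
    exact ⟨.appL .hole (ρ y) (hρ y), fun s => ECtx.sem_appVar hxy ρ s⟩
  | varApp u E x y h ih =>
    obtain ⟨hxy, hE, hd⟩ := hf.varApp
    refine ECtx.good_plugCrumble (C := .snoc (.ret (.app x y)) y) trivial (fun ρ hρ => ?_) (ih hE) hd
    exact ⟨.appR (ρ x) .hole, fun s => ECtx.sem_varApp hxy ρ s⟩
  | app u u' E E' x y h h' ih ih' =>
    obtain ⟨hxy, hy, hE, hE', hd, hd'⟩ := hf.app h.fv_subset
    refine ECtx.good_plugCrumble ?_ (fun ρ hρ => ?_) (ih' hE') hd'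
    · refine ECtx.good_plugCrumble (C := .snoc (.ret (.app x y)) x) trivial (fun ρ hρ => ?_) (ih hE) hd
      exact ⟨.appL .hole (ρ y) (hρ y), fun s => ECtx.sem_appVar hxy ρ s⟩
    · exact ⟨.appR (E.sem ρ) .hole, fun s => ECtx.sem_app hxy hy hd ρ s⟩

theorem up_eq_up {R : Var → Var → Prop} {ρ ρ' : Var → Term} (h : ∀ x x', ρ x = ρ' x' → R x x')
    (u w x x' : Var) (hx : up ρ u x = up ρ' w x') : bindRel R u w x x' := by
  have lift_ne : ∀ t : Term, lift 0 t ≠ bvar 0 := fun t => by cases t <;> simp [lift]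
  by_cases h1 : x = u <;> by_cases h2 : x' = w
  · exact Or.inl ⟨h1, h2⟩
  · subst h1; simp only [up, Function.update_self, Function.update_of_ne h2] at hx
    exact (lift_ne _ hx.symm).elim
  · subst h2; simp only [up, Function.update_self, Function.update_of_ne h1] at hx
    exact (lift_ne _ hx).elim
  · simp only [up, Function.update_of_ne h1, Function.update_of_ne h2] at hx
    exact Or.inr ⟨h1, h2, h _ _ (lift_inj 0 hx)⟩

theorem isVar_up {ρ : Var → Term} (hρ : ∀ x, (ρ x).IsVar) (u x : Var) : (up ρ u x).IsVar := by
  by_cases h : x = u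
  · subst h; simp [up, IsVar]
  · simpa [up, h] using (hρ x).lift 0

/-- The crumbling is unique: renamings `ρ` and `ρ'` that make two terms equal identify the free
variables of their crumblings along `R`. -/
theorem Translates.alphaRel {t : Term} {E : Crumble} (h : Translates t E) (hf : E.Fresh t.fv)
    {t' : Term} {E' : Crumble} (h' : Translates t' E') (hf' : E'.Fresh t'.fv)
    {R : Var → Var → Prop} {ρ ρ' : Var → Term} (hρ : ∀ x, (ρ x).IsVar) (hρ' : ∀ x, (ρ' x).IsVar)
    (hR : ∀ x x', ρ x = ρ' x' → R x x') (ht : msub ρ t = msub ρ' t') : E.AlphaRel R E' := by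
  induction h generalizing t' E' R ρ ρ' with
  | appVarVar x y =>
    cases h' with
    | appVarVar x' y' => exact .ret (.app (hR _ _ (app.inj ht).1) (hR _ _ (app.inj ht).2))
    | lamVar x' y' => cases ht
    | lam x' t' E' h' => cases ht
    | appVar u' E' x' y' h' => exact (h'.not_isVar_msub ρ' ((app.inj ht).1 ▸ hρ x)).elim
    | varApp u' E' x' y' h' => exact (h'.not_isVar_msub ρ' ((app.inj ht).2 ▸ hρ y)).elim
    | app u' w' E' F' x' y' h' g' => exact (h'.not_isVar_msub ρ' ((app.inj ht).1 ▸ hρ x)).elim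
  | lamVar x y =>
    cases h' with
    | lamVar x' y' =>
      rw [msub_abs, msub_abs] at ht
      exact .ret (.lamVar (up_eq_up hR _ _ _ _ (lam.inj ht)))
    | lam x' t' E' h' =>
      rw [msub_abs, msub_abs, lam.injEq, msub] at ht
      exact (h'.not_isVar_msub _ (ht ▸ isVar_up hρ x y)).elim
    | _ => cases ht
  | lam x t E h ih =>
    cases h' with
    | lamVar x' y' =>
      rw [msub_abs, msub_abs, lam.injEq] at ht
      exact (h.not_isVar_msub _ (by rw [ht]; exact isVar_up hρ' x' y')).elim
    | lam x' t' E' h' =>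
      rw [msub_abs, msub_abs] at ht
      exact .ret (.lam (ih hf.lam h' hf'.lam (isVar_up hρ x) (isVar_up hρ' x')
        (fun _ _ e => up_eq_up hR _ _ _ _ e) (lam.inj ht)))
    | _ => cases ht
  | appVar u E x y h ih =>
    cases h' with
    | appVarVar x' y' => exact (h.not_isVar_msub ρ ((app.inj ht).1 ▸ hρ' x')).elim
    | lamVar x' y' => cases ht
    | lam x' t' E' h' => cases ht
    | appVar u' E' x' y' h' =>
      obtain ⟨hxy, hE, hd⟩ := hf.appVar
      obtain ⟨hxy', hE', hd'⟩ := hf'.appVar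
      refine ECtx.AlphaRel.plugCrumble (.snoc (.ret (.app (.inl ⟨rfl, rfl⟩) ?_)))
        (ih hE h' hE' hρ hρ' hR (app.inj ht).1) hd hd'
      exact .inr ⟨hxy.symm, hxy'.symm, hR _ _ (app.inj ht).2⟩
    | varApp u' E' x' y' h' => exact (h.not_isVar_msub ρ ((app.inj ht).1 ▸ hρ' x')).elim
    | app u' w' E' F' x' y' h' g' => exact (g'.not_isVar_msub ρ' ((app.inj ht).2 ▸ hρ y)).elim
  | varApp u E x y h ih =>
    cases h' with
    | appVarVar x' y' => exact (h.not_isVar_msub ρ ((app.inj ht).2 ▸ hρ' y')).elim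
    | lamVar x' y' => cases ht
    | lam x' t' E' h' => cases ht
    | appVar u' E' x' y' h' => exact (h.not_isVar_msub ρ ((app.inj ht).2 ▸ hρ' y')).elim
    | varApp u' E' x' y' h' =>
      obtain ⟨hxy, hE, hd⟩ := hf.varApp
      obtain ⟨hxy', hE', hd'⟩ := hf'.varApp
      refine ECtx.AlphaRel.plugCrumble (.snoc (.ret (.app ?_ (.inl ⟨rfl, rfl⟩))))
        (ih hE h' hE' hρ hρ' hR (app.inj ht).2) hd hd'
      exact .inr ⟨hxy, hxy', hR _ _ (app.inj ht).1⟩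
    | app u' w' E' F' x' y' h' g' => exact (h'.not_isVar_msub ρ' ((app.inj ht).1 ▸ hρ x)).elim
  | app u w E F x y h g ih ih' =>
    cases h' with
    | appVarVar x' y' => exact (h.not_isVar_msub ρ ((app.inj ht).1 ▸ hρ' x')).elim
    | lamVar x' y' => cases ht
    | lam x' t' E' h' => cases ht
    | appVar u' E' x' y' h' => exact (g.not_isVar_msub ρ ((app.inj ht).2 ▸ hρ' y')).elim
    | varApp u' E' x' y' h' => exact (h.not_isVar_msub ρ ((app.inj ht).1 ▸ hρ' x')).elim
    | app u' w' E' F' x' y' h' g' =>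
      obtain ⟨hxy, hy, hE, hF, hd, he⟩ := hf.app h.fv_subset
      obtain ⟨hxy', hy', hE', hF', hd', he'⟩ := hf'.app h'.fv_subset
      refine ECtx.AlphaRel.plugCrumble (.snoc ?_) (ih' hF g' hF' hρ hρ' hR (app.inj ht).2) he he'
      refine ECtx.AlphaRel.plugCrumble
        (.snoc (.ret (.app (.inl ⟨rfl, rfl⟩) (.inr ⟨hxy.symm, hxy'.symm, .inl ⟨rfl, rfl⟩⟩))))
        ?_ hd hd'
      exact (ih hE h' hE' hρ hρ' hR (app.inj ht).1).mono fun z z' hz hz' hzz =>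
        .inr ⟨fun e => hy (e ▸ hz), fun e => hy' (e ▸ hz'), hzz⟩

/-- The number of constructors of a term. -/
def Term.size : Term → ℕ
  | bvar _ => 1
  | fvar _ => 1
  | lam t => t.size + 1
  | app t u => t.size + u.size + 1

theorem Term.size_openAt_fvar (x : Var) (k : ℕ) (t : Term) :
    (openAt (fvar x) k t).size = t.size := by
  induction t generalizing k with
  | bvar i => simp only [openAt]; split_ifs <;> rfl
  | fvar y => rfl
  | lam t ih => simp only [openAt, size, ih]
  | app t u iht ihu => simp only [openAt, size, iht, ihu]

/-- Every locally closed term that is not a variable has a crumbling whose binders avoid a given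
finite set. The induction is on the size, because bodies are opened with fresh names. -/
theorem exists_translates : ∀ (n : ℕ) (t : Term), t.size ≤ n → lcAt 0 t → ∀ S : Finset Var,
    t.fv ⊆ S → (∃ y, t = .fvar y) ∨
      ∃ E, Translates t E ∧ E.Fresh S ∧ ∀ z ∈ E.bv, z ∉ S := by
  intro n
  induction n with
  | zero => intro t ht; cases t <;> simp [Term.size] at ht
  | succ n ih =>
    intro t ht hlc S hS
    cases t with
    | bvar i => exact absurd hlc (Nat.not_lt_zero i)
    | fvar x => exact .inl ⟨x, rfl⟩
    | lam t =>
      right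
      obtain ⟨x, hx⟩ := Infinite.exists_notMem_finset S
      have hxt : x ∉ t.fv := fun h => hx (hS h)
      have ht' : Term.lam t = abs x (openAt (fvar x) 0 t) := by
        rw [Term.abs, closeAt_openAt hxt]
      rw [ht']
      rcases ih (openAt (fvar x) 0 t)
        (by rw [size_openAt_fvar]; simp only [Term.size] at ht; omega)
        (lcAt.openAt (k := 0) hlc trivial) (insert x S)
        ((fv_openAt_fvar x 0 t).trans (Finset.insert_subset_insert x hS)) with ⟨y, hy⟩ | ⟨E, hE⟩
      · rw [hy]
        exact ⟨_, .lamVar x y, by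
          simpa [Crumble.Fresh, Crumble.allDom, Bite.allDom, Crumble.bv, Bite.bv] using hx⟩
      · obtain ⟨hE, hf, hb⟩ := hE
        simp only [Finset.mem_insert, not_or] at hb
        refine ⟨_, .lam x _ E hE, ⟨hf.1, fun z hz => ?_⟩, fun z hz => ?_⟩
        · have := hf.2 z hz
          simp only [Finset.mem_insert, Crumble.bv, Bite.bv, not_or] at *
          tauto
        · simp only [Crumble.bv, Bite.bv, Finset.mem_insert] at hz
          rcases hz with rfl | hz
          · exact hx
          · exact (hb z hz).2
    | app t u =>
      right
      have htS : t.fv ⊆ S := fun z hz => hS (by simp [Term.fv, hz])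
      have huS : u.fv ⊆ S := fun z hz => hS (by simp [Term.fv, hz])
      simp only [Term.size] at ht
      rcases ih t (by omega) hlc.1 S htS with ⟨x, rfl⟩ | ⟨E, hE, hf, hb⟩
      · rcases ih u (by omega) hlc.2 S huS with ⟨y, rfl⟩ | ⟨E', hE', hf', hb'⟩
        · exact ⟨_, .appVarVar x y, by
            simp [Crumble.Fresh, Crumble.allDom, Bite.allDom, Crumble.bv, Bite.bv]⟩
        · obtain ⟨y, hy⟩ := Infinite.exists_notMem_finset (S ∪ E'.allDom.toFinset ∪ E'.bv)
          simp only [Finset.mem_union, List.mem_toFinset, not_or] at hy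
          refine ⟨_, .varApp u E' x y hE', Crumble.fresh_plugCrumble.2 ?_, ?_⟩
          · simp only [Crumble.Fresh, Crumble.allDom, Bite.allDom, Crumble.bv, Bite.bv] at *
            simp
            tauto
          · simpa [ECtx.bv_plugCrumble, ECtx.bv, Crumble.bv, Bite.bv] using hb'
      · -- The crumbling of the argument has to avoid the variables of that of the function.
        rcases ih u (by omega) hlc.2 (S ∪ E.allDom.toFinset ∪ E.bv)
          (huS.trans (by intro z hz; simp [hz])) with ⟨y, rfl⟩ | ⟨E', hE', hf', hb'⟩
        · obtain ⟨x, hx⟩ := Infinite.exists_notMem_finset (S ∪ E.allDom.toFinset ∪ E.bv)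
          simp only [Finset.mem_union, List.mem_toFinset, not_or] at hx
          refine ⟨_, .appVar t E x y hE, Crumble.fresh_plugCrumble.2 ?_, ?_⟩
          · simp only [Crumble.Fresh, Crumble.allDom, Bite.allDom, Crumble.bv, Bite.bv] at *
            simp
            tauto
          · simpa [ECtx.bv_plugCrumble, ECtx.bv, Crumble.bv, Bite.bv] using hb
        · obtain ⟨x, hx⟩ := Infinite.exists_notMem_finset
            (S ∪ E.allDom.toFinset ∪ E.bv ∪ E'.allDom.toFinset ∪ E'.bv)
          obtain ⟨y, hy⟩ := Infinite.exists_notMem_finset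
            (insert x (S ∪ E.allDom.toFinset ∪ E.bv ∪ E'.allDom.toFinset ∪ E'.bv))
          simp only [Crumble.Fresh, Finset.mem_insert, Finset.mem_union, List.mem_toFinset,
            not_or] at hx hy hf' hb'
          have hp := fun w => (ECtx.allDom_plugCrumble (.ret (.app x y)) x E).mem_iff (a := w)
          simp only [List.mem_cons, Crumble.allDom, Bite.allDom, List.nil_append] at hp
          have hbv : ((ECtx.snoc (.ret (.app x y)) x).plugCrumble E).bv = E.bv := by
            simp [ECtx.bv_plugCrumble, ECtx.bv, Crumble.bv, Bite.bv]
          refine ⟨_, .app t u E E' x y hE hE', Crumble.fresh_plugCrumble.2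
            ⟨⟨hy.2.1.1.1.1, ?_, hy.2.1.2, ?_, hy.2.2⟩, Crumble.fresh_plugCrumble.2 ?_, ?_, ?_, ?_⟩, ?_⟩
          · rw [hp]; tauto
          · rw [hbv]; tauto
          · simp only [Crumble.Fresh, Crumble.allDom, Bite.allDom, Crumble.bv, Bite.bv] at *
            simp
            tauto
          · exact ⟨hf'.1, fun z hz => ⟨(hf'.2 z hz).1.1.1, (hf'.2 z hz).2⟩⟩
          · intro w hw
            rcases (hp w).1 hw with rfl | hw
            · tauto
            · exact ⟨fun h => (hf'.2 w h).1.1.2 hw, fun h => (hb' w h).1.2 hw⟩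
          · intro w hw
            rw [hbv]
            exact (hf'.2 w hw).1.2
          · intro w hw
            rw [ECtx.bv_plugCrumble, ECtx.bv, hbv, Finset.mem_union] at hw
            rcases hw with hw | hw
            · exact hb w hw
            · exact (hb' w hw).1.1

/-! ### Environments -/

/-- The domain of an environment. -/
def Env.dom (Ev : Env) : List Var := Ev.map Prod.fst

/-- Every variable that is free in an entry is assigned to further to the right. -/
def Env.Scoped : Env → Prop
  | [] => True
  | e :: Ev => (∀ x ∈ e.2.fv, x ∈ Env.dom Ev) ∧ Env.Scoped Ev

/-- The environment of terms that the entries of `Ev` define on top of `ρ`. -/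
def Env.sem (ρ : Var → Term) : Env → Var → Term
  | [] => ρ
  | e :: Ev => Function.update (Env.sem ρ Ev) e.1 (e.2.sem (Env.sem ρ Ev))

theorem Crumble.sem_append (c : Crumble) (Ev : Env) (ρ : Var → Term) :
    (c.append Ev).sem ρ = c.sem (Env.sem ρ Ev) := by
  induction Ev generalizing c with
  | nil => rfl
  | cons e Ev ih => exact ih (c.snoc e.1 e.2)

theorem Crumble.dom_append (c : Crumble) (Ev : Env) :
    (c.append Ev).dom = (Env.dom Ev).reverse ++ c.dom := by
  induction Ev generalizing c with
  | nil => rfl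
  | cons e Ev ih =>
    refine (ih (c.snoc e.1 e.2)).trans ?_
    simp [Env.dom, Crumble.dom]

theorem Crumble.mem_bv_append (c : Crumble) (Ev : Env) (x : Var) :
    x ∈ (c.append Ev).bv ↔ x ∈ c.bv ∨ ∃ e ∈ Ev, x ∈ e.2.bv := by
  induction Ev generalizing c with
  | nil => simp [Crumble.append]
  | cons e Ev ih =>
    refine (ih (c.snoc e.1 e.2)).trans ?_
    simp [Crumble.bv, or_assoc]

theorem Crumble.names_subset_append (c : Crumble) (Ev : Env) : c.names ⊆ (c.append Ev).names := by
  induction Ev generalizing c with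
  | nil => exact Finset.Subset.refl _
  | cons e Ev ih =>
    refine Finset.Subset.trans ?_ (ih (c.snoc e.1 e.2))
    intro z hz
    simp [Crumble.names, hz]

mutual
theorem Bite.fv_subset_names : ∀ b : Bite, b.fv ⊆ b.names
  | .app _ _ => Finset.Subset.refl _
  | .lamVar _ _ => by intro z; simp only [Bite.fv, Bite.names]; simp; tauto
  | .lam x E => by
      intro z hz
      have := @Crumble.fv_subset_names E z
      simp only [Bite.fv, Bite.names, Finset.mem_sdiff, Finset.mem_insert] at *
      tauto
theorem Crumble.fv_subset_names : ∀ E : Crumble, E.fv ⊆ E.names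
  | .ret b => Bite.fv_subset_names b
  | .snoc E x b => by
      intro z hz
      have := @Crumble.fv_subset_names E z
      have := @Bite.fv_subset_names b z
      simp only [Crumble.fv, Crumble.names, Finset.mem_sdiff, Finset.mem_insert,
        Finset.mem_union] at *
      tauto
end

mutual
theorem Bite.bv_subset_names : ∀ b : Bite, b.bv ⊆ b.names
  | .app _ _ => by simp [Bite.bv]
  | .lamVar x y => by simp [Bite.bv, Bite.names]
  | .lam x E => Finset.insert_subset_insert x (Crumble.bv_subset_names E)
theorem Crumble.bv_subset_names : ∀ E : Crumble, E.bv ⊆ E.names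
  | .ret b => Bite.bv_subset_names b
  | .snoc E _ b => (Finset.union_subset_union (Crumble.bv_subset_names E)
      (Bite.bv_subset_names b)).trans (Finset.subset_insert _ _)
end

theorem Crumble.dom_subset_names : ∀ (E : Crumble), ∀ x ∈ E.dom, x ∈ E.names
  | .ret _, x, h => by simp [Crumble.dom] at h
  | .snoc E z b, x, h => by
      simp only [Crumble.dom, List.mem_cons] at h
      simp only [Crumble.names, Finset.mem_insert, Finset.mem_union]
      exact h.imp id fun h => .inl (Crumble.dom_subset_names E x h)

theorem Crumble.dom_subset_names_append (c : Crumble) (Ev : Env) :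
    ∀ x ∈ Env.dom Ev, x ∈ (c.append Ev).names := fun x hx =>
  Crumble.dom_subset_names _ x (by simp [Crumble.dom_append, hx])

theorem Crumble.fv_append_eq_foldl (c : Crumble) (Ev : Env) :
    (c.append Ev).fv = Ev.foldl (fun s e => (s \ {e.1}) ∪ e.2.fv) c.fv := by
  induction Ev generalizing c with
  | nil => rfl
  | cons e Ev ih => exact ih (c.snoc e.1 e.2)

theorem Env.fv_subset_append (c : Crumble) (Ev : Env) : Env.fv Ev ⊆ (c.append Ev).fv := by
  have key : ∀ (Ev : Env) (s s' : Finset Var), s ⊆ s' →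
      Ev.foldl (fun s e => (s \ {e.1}) ∪ e.2.fv) s ⊆
        Ev.foldl (fun s e => (s \ {e.1}) ∪ e.2.fv) s' := by
    intro Ev
    induction Ev with
    | nil => exact fun _ _ h => h
    | cons e Ev ih =>
      exact fun s s' h => ih _ _ (Finset.union_subset_union
        (Finset.sdiff_subset_sdiff h (Finset.Subset.refl _)) (Finset.Subset.refl _))
  rw [Crumble.fv_append_eq_foldl]
  exact key Ev _ _ (Finset.empty_subset _)

theorem Crumble.fv_append_eq_empty {c : Crumble} {Ev : Env} :
    (c.append Ev).fv = ∅ ↔ (∀ x ∈ c.fv, x ∈ Env.dom Ev) ∧ Env.Scoped Ev := by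
  induction Ev generalizing c with
  | nil => simp [Crumble.append, Env.dom, Env.Scoped, Finset.eq_empty_iff_forall_notMem]
  | cons e Ev ih =>
    refine (ih (c := c.snoc e.1 e.2)).trans ?_
    simp only [Crumble.fv, Finset.mem_union, Finset.mem_sdiff, Finset.mem_singleton, Env.dom,
      List.map_cons, List.mem_cons, Env.Scoped]
    constructor
    · rintro ⟨h1, h2⟩
      exact ⟨fun x hx => or_iff_not_imp_left.2 fun hne => h1 x (.inl ⟨hx, hne⟩),
        fun x hx => h1 x (.inr hx), h2⟩
    · rintro ⟨h1, h2, h3⟩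
      exact ⟨fun x hx => hx.elim (fun hx => (h1 x hx.1).resolve_left hx.2) (h2 x), h3⟩

theorem Env.exists_get {x : Var} : ∀ {Ev : Env}, x ∈ Env.dom Ev → ∃ v, Env.get x Ev = some v
  | [], h => by simp [Env.dom] at h
  | e :: Ev, h => by
      by_cases hx : e.1 = x
      · exact ⟨e.2, if_pos hx⟩
      · obtain ⟨v, hv⟩ := Env.exists_get (Ev := Ev) (x := x) (by
          simp only [Env.dom, List.map_cons, List.mem_cons] at h
          exact h.resolve_left (Ne.symm hx))
        exact ⟨v, (if_neg hx).trans hv⟩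

theorem Env.mem_of_get {x : Var} {v : Bite} : ∀ {Ev : Env}, Env.get x Ev = some v →
    ∃ e ∈ Ev, e.2 = v
  | e :: Ev, h => by
      simp only [Env.get] at h
      split_ifs at h with hx
      · exact ⟨e, by simp, Option.some.inj h⟩
      · obtain ⟨e', he', hv⟩ := Env.mem_of_get h
        exact ⟨e', by simp [he'], hv⟩

theorem Env.fv_of_get {x : Var} {v : Bite} : ∀ {Ev : Env}, Env.Scoped Ev →
    Env.get x Ev = some v → ∀ z ∈ v.fv, z ∈ Env.dom Ev
  | e :: Ev, hs, h, z, hz => by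
      simp only [Env.get] at h
      simp only [Env.dom, List.map_cons, List.mem_cons]
      split_ifs at h with hx
      · cases h; exact .inr (hs.1 z hz)
      · exact .inr (Env.fv_of_get hs.2 h z hz)

theorem Env.sem_get {x : Var} {v : Bite} (ρ : Var → Term) : ∀ {Ev : Env}, Env.Scoped Ev →
    (Env.dom Ev).Nodup → Env.get x Ev = some v → Env.sem ρ Ev x = v.sem (Env.sem ρ Ev)
  | e :: Ev, hs, hn, h => by
      simp only [Env.get] at h
      simp only [Env.dom, List.map_cons, List.nodup_cons] at hn
      -- The entry `e` does not affect values of entries to its right.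
      have key : ∀ b : Bite, (∀ z ∈ b.fv, z ∈ Env.dom Ev) →
          b.sem (Env.sem ρ Ev) = b.sem (Env.sem ρ (e :: Ev)) := fun b hb =>
        b.sem_congr fun z hz =>
          (Function.update_of_ne (fun h : z = e.1 => hn.1 (h ▸ hb z hz)) _ _).symm
      split_ifs at h with hx
      · cases h
        rw [← key _ hs.1, ← hx]
        exact Function.update_self _ _ _
      · rw [← key _ (Env.fv_of_get hs.2 h), ← Env.sem_get ρ hs.2 hn.2 h]
        exact Function.update_of_ne (Ne.symm hx) _ _

theorem Env.isValue_sem : ∀ {Ev : Env}, Env.IsV Ev → ∀ x, (Env.sem .fvar Ev x).IsValue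
  | [], _, _ => trivial
  | e :: Ev, h, x => by
      simp only [Env.sem]
      by_cases hx : x = e.1
      · subst hx
        rw [Function.update_self]
        have := h e (by simp)
        revert this
        cases e.2 <;> exact id
      · rw [Function.update_of_ne hx]
        exact Env.isValue_sem (fun e he => h e (by simp [he])) x

theorem Env.lcAt_sem : ∀ (Ev : Env) (x : Var), lcAt 0 (Env.sem .fvar Ev x)
  | [], _ => trivial
  | e :: Ev, x => by
      simp only [Env.sem]
      by_cases hx : x = e.1
      · subst hx
        rw [Function.update_self]
        exact Bite.lcAt_sem _ (Env.lcAt_sem Ev)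
      · rw [Function.update_of_ne hx]
        exact Env.lcAt_sem Ev x

theorem Crumble.Good.of_append : ∀ {Ev : Env} {c : Crumble}, (c.append Ev).Good →
    c.Good ∧ ∀ e ∈ Ev, e.2.Good
  | [], _, h => ⟨h, by simp⟩
  | e :: Ev, c, h => by
      obtain ⟨h1, h2⟩ := Crumble.Good.of_append (Ev := Ev) (c := c.snoc e.1 e.2) h
      simp only [List.mem_cons, forall_eq_or_imp]
      exact ⟨h1.1, h1.2.1, h2⟩

theorem Crumble.Good.append : ∀ {Ev : Env} {c : Crumble}, c.Good → (∀ e ∈ Ev, e.2.Good) →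
    Env.IsV Ev → (c.append Ev).Good
  | [], _, h, _, _ => h
  | e :: Ev, c, h, he, hv => by
      simp only [Env.IsV, List.mem_cons, forall_eq_or_imp] at he hv
      exact Crumble.Good.append (Ev := Ev) (c := c.snoc e.1 e.2)
        ⟨h, he.1, fun hn => (hn hv.1).elim⟩ he.2 hv.2

/-- Environments that are equal up to bound variables and up to `R` on the free ones. The last
argument is the relation that results from `R` in the scope of the two environments. -/
inductive Env.AlphaRel (R : Var → Var → Prop) : Env → Env → (Var → Var → Prop) → Prop
  | nil : Env.AlphaRel R [] [] R
  | cons {Ev Ev' : Env} {S : Var → Var → Prop} {x x' : Var} {b b' : Bite}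
      (h : Env.AlphaRel R Ev Ev' S) (hb : b.AlphaRel S b') :
      Env.AlphaRel R ((x, b) :: Ev) ((x', b') :: Ev') (bindRel S x x')

theorem Env.AlphaRel.append {R S : Var → Var → Prop} {Ev Ev' : Env} (h : Env.AlphaRel R Ev Ev' S)
    {c c' : Crumble} (hc : c.AlphaRel S c') : (c.append Ev).AlphaRel R (c'.append Ev') := by
  induction h generalizing c c' with
  | nil => exact hc
  | cons _ hb ih => exact ih (.snoc hc hb)

theorem Env.AlphaRel.of_append {R : Var → Var → Prop} : ∀ {Ev Ev' : Env} {c c' : Crumble},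
    Ev.length = Ev'.length → (c.append Ev).AlphaRel R (c'.append Ev') →
    ∃ S, Env.AlphaRel R Ev Ev' S ∧ c.AlphaRel S c'
  | [], [], _, _, _, h => ⟨R, .nil, h⟩
  | e :: Ev, e' :: Ev', c, c', hl, h => by
      obtain ⟨S, hS, hc⟩ := Env.AlphaRel.of_append (Ev := Ev) (Ev' := Ev') (c := c.snoc e.1 e.2)
        (c' := c'.snoc e'.1 e'.2) (by simpa using hl) h
      cases hc with
      | snoc hE hb => exact ⟨_, .cons hS hb, hE⟩

open Classical in
/-- The number of values at the right end of a crumble, not counting the assignment to `*`. -/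
noncomputable def Crumble.numValues : Crumble → ℕ
  | .ret _ => 0
  | .snoc E _ b => if b.IsValue then E.numValues + 1 else 0

/-- The number of values at the right end is invariant, so that corresponding crumbles are cut at the
same rightmost application. -/
theorem Crumble.AlphaRel.numValues_eq : ∀ {E E' : Crumble} {R : Var → Var → Prop},
    E.AlphaRel R E' → E.numValues = E'.numValues
  | _, _, _, .ret _ => rfl
  | _, _, _, .snoc hE hb => by
      simp only [Crumble.numValues, hE.numValues_eq]
      classical exact if_congr hb.isValue rfl rfl

theorem Crumble.numValues_append : ∀ {Ev : Env} {c : Crumble}, Env.IsV Ev →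
    (c.append Ev).numValues = c.numValues + Ev.length
  | [], _, _ => rfl
  | e :: Ev, c, h => by
      simp only [Env.IsV, List.mem_cons, forall_eq_or_imp] at h
      refine (Crumble.numValues_append (Ev := Ev) (c := c.snoc e.1 e.2) h.2).trans ?_
      simp only [Crumble.numValues, if_pos h.1, List.length_cons]
      omega

theorem ECtx.numValues_plug_app (C : ECtx) (x y : Var) : (C.plug (.app x y)).numValues = 0 := by
  cases C
  · rfl
  · exact if_neg id

/-- Entries are related in the scope of what stands to their right; since the environments are
scoped and have distinct domains, they are also related in the final scope. -/
theorem Env.AlphaRel.get {R S : Var → Var → Prop} {Ev Ev' : Env} (h : Env.AlphaRel R Ev Ev' S)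
    (hs : Env.Scoped Ev) (hs' : Env.Scoped Ev') (hn : (Env.dom Ev).Nodup)
    (hn' : (Env.dom Ev').Nodup) {x x' : Var} (hx : S x x') {v v' : Bite}
    (hv : Env.get x Ev = some v) (hv' : Env.get x' Ev' = some v') : v.AlphaRel S v' := by
  induction h with
  | nil => cases hv
  | @cons Ev Ev' S u u' b b' h hb ih =>
    simp only [Env.dom, List.map_cons, List.nodup_cons] at hn hn'
    have key : ∀ {c c' : Bite}, (∀ z ∈ c.fv, z ∈ Env.dom Ev) → (∀ z ∈ c'.fv, z ∈ Env.dom Ev') →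
        c.AlphaRel S c' → c.AlphaRel (bindRel S u u') c' := fun hc hc' hcc =>
      hcc.mono fun z z' hz hz' hzz =>
        .inr ⟨fun e => hn.1 (e ▸ hc z hz), fun e => hn'.1 (e ▸ hc' z' hz'), hzz⟩
    rcases hx with ⟨rfl, rfl⟩ | ⟨h1, h2, hx⟩
    · simp only [Env.get, if_true] at hv hv'
      cases hv; cases hv'
      exact key hs.1 hs'.1 hb
    · simp only [Env.get, if_neg (Ne.symm h1), if_neg (Ne.symm h2)] at hv hv'
      exact key (Env.fv_of_get hs.2 hv) (Env.fv_of_get hs'.2 hv')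
        (ih hs.2 hs'.2 hn.2 hn'.2 hx hv hv')

/-! ### Transitions -/

/-- The application `x y` unfolds to the crumble `B` in the environment `Ev`. -/
inductive Env.Unfolds (Ev : Env) (x y : Var) : Crumble → Prop
  | body {v : Bite} {x₁ : Var} {E : Crumble} (hx : Env.get x Ev = some v)
      (hα : v.AlphaRel Eq (.lam x₁ E)) (hb : y ∉ E.bv) (hd : y ∉ E.allDom) :
      Env.Unfolds Ev x y (E.subst x₁ y)
  | value {x₁ y₁ : Var} {v : Bite} (hx : Env.get x Ev = some (.lamVar x₁ y₁))
      (hv : Env.get (if y₁ = x₁ then y else y₁) Ev = some v) : Env.Unfolds Ev x y (.ret v)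

theorem Crumble.dom_subst (x y : Var) : ∀ E : Crumble, (E.subst x y).dom = E.dom
  | .ret _ => rfl
  | .snoc E z b => by
      simp only [Crumble.subst, Crumble.dom]
      split_ifs
      · rfl
      · rw [Crumble.dom_subst x y E]

mutual
theorem Bite.bv_subst (x y : Var) : ∀ b : Bite, (b.subst x y).bv = b.bv
  | .app _ _ => rfl
  | .lamVar _ _ => by simp only [Bite.subst]; split_ifs <;> rfl
  | .lam z E => by
      simp only [Bite.subst]
      split_ifs
      · rfl
      · simp only [Bite.bv, Crumble.bv_subst x y E]
theorem Crumble.bv_subst (x y : Var) : ∀ E : Crumble, (E.subst x y).bv = E.bv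
  | .ret b => Bite.bv_subst x y b
  | .snoc E z b => by
      simp only [Crumble.subst, Crumble.bv, Bite.bv_subst x y b]
      split_ifs
      · rfl
      · rw [Crumble.bv_subst x y E]
end

theorem Bite.AlphaRel.fv_subset {b b' : Bite} (h : b.AlphaRel Eq b') : b'.fv ⊆ b.fv := fun z hz => by
  obtain ⟨x, hx, rfl⟩ := h.exists_mem_fv z hz
  exact hx

theorem Env.Unfolds.fv_subset {Ev : Env} {x y : Var} {B : Crumble} (h : Env.Unfolds Ev x y B)
    (hs : Env.Scoped Ev) (hy : y ∈ Env.dom Ev) : ∀ z ∈ B.fv, z ∈ Env.dom Ev := by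
  cases h with
  | @body v x₁ E hx hα hb hd =>
    intro z hz
    obtain ⟨u, hu, rfl⟩ := (E.alphaRel_subst (x := x₁) (R := fun u w => w = if u = x₁ then y else u)
      hb hd fun _ => rfl).exists_mem_fv z hz
    split_ifs with hux
    · exact hy
    · exact Env.fv_of_get hs hx u (hα.fv_subset (by simp [Bite.fv, hu, hux]))
  | value hx hv => exact Env.fv_of_get hs hv

theorem Env.Unfolds.good {Ev : Env} {x y : Var} {B : Crumble} (h : Env.Unfolds Ev x y B)
    (hg : ∀ e ∈ Ev, e.2.Good) : B.Good := by
  cases h with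
  | @body v x₁ E hx hα hb hd =>
    obtain ⟨e, he, rfl⟩ := Env.mem_of_get hx
    have hE : E.Good := hα.good (fun _ _ _ h h' => h.symm.trans h') (hg e he)
    exact (E.alphaRel_subst (x := x₁) (R := fun u w => w = if u = x₁ then y else u)
      hb hd fun _ => rfl).good (fun _ _ _ h h' => h.trans h'.symm) hE
  | value hx hv =>
    obtain ⟨e, he, rfl⟩ := Env.mem_of_get hv
    exact hg e he

/-- Unfolding an application in an environment of values is a β-step on the read-backs. -/
theorem Env.Unfolds.sem_eq {Ev : Env} {x y : Var} {B : Crumble} (h : Env.Unfolds Ev x y B)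
    (hs : Env.Scoped Ev) (hn : (Env.dom Ev).Nodup) :
    ∃ t, Env.sem .fvar Ev x = .lam t ∧
      openAt (Env.sem .fvar Ev y) 0 t = B.sem (Env.sem .fvar Ev) := by
  have hlc := Env.lcAt_sem Ev
  cases h with
  | @body v x₁ E hx hα hb hd =>
    refine ⟨_, (Env.sem_get _ hs hn hx).trans (hα.sem_eq fun _ _ => congrArg _), ?_⟩
    rw [Crumble.openAt_sem _ (hlc y), openAt_up_zero hlc]
    refine (E.alphaRel_subst (x := x₁) (R := fun u w => w = if u = x₁ then y else u)
      hb hd fun _ => rfl).sem_eq ?_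
    rintro u _ rfl
    by_cases hu : u = x₁
    · subst hu; simp
    · simp [hu]
  | @value x₁ y₁ v hx hv =>
    refine ⟨_, Env.sem_get _ hs hn hx, ?_⟩
    rw [congrFun (openAt_up_zero hlc _ x₁) y₁, Crumble.sem, ← Env.sem_get _ hs hn hv]
    by_cases hu : y₁ = x₁
    · subst hu; simp
    · simp [hu]

/-- In corresponding environments, corresponding applications unfold to corresponding crumbles,
whichever α-variants of the abstractions are chosen. -/
theorem Env.Unfolds.alphaRel {R S : Var → Var → Prop} {Ev Ev' : Env} (h : Env.AlphaRel R Ev Ev' S)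
    (hs : Env.Scoped Ev) (hs' : Env.Scoped Ev') (hn : (Env.dom Ev).Nodup)
    (hn' : (Env.dom Ev').Nodup) {x y x' y' : Var} (hx : S x x') (hy : S y y') {B B' : Crumble}
    (hB : Env.Unfolds Ev x y B) (hB' : Env.Unfolds Ev' x' y' B') : B.AlphaRel S B' := by
  cases hB with
  | @body v x₁ E hv hα hb hd =>
    cases hB' with
    | @body v' x₁' E' hv' hα' hb' hd' =>
      have hvv := h.get hs hs' hn hn' hx hv hv'
      have hE := ((hα.symm (S := Eq) fun _ _ => Eq.symm).comp hvv (T := S)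
        (by rintro _ _ _ rfl h; exact h)).comp hα' (T := S) (by rintro _ _ _ h rfl; exact h)
      cases hE with
      | lam hE =>
        have h1 := (E.alphaRel_subst (x := x₁) (R := fun u w => w = if u = x₁ then y else u)
          hb hd fun _ => rfl).symm (S := fun w u => w = if u = x₁ then y else u) fun _ _ => id
        have h2 := E'.alphaRel_subst (x := x₁') (R := fun u w => w = if u = x₁' then y' else u)
          hb' hd' fun _ => rfl
        refine ((h1.comp hE (T := fun w u' => ∃ u, w = (if u = x₁ then y else u) ∧
          bindRel S x₁ x₁' u u') fun _ u _ hw hu => ⟨u, hw, hu⟩).comp h2) ?_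
        rintro _ u' _ ⟨u, rfl, ⟨rfl, rfl⟩ | ⟨h1, h2, h3⟩⟩ rfl
        · simpa using hy
        · simpa [h1, h2] using h3
    | value hv' hw' =>
      have hvv := h.get hs hs' hn hn' hx hv hv'
      cases hα; cases hvv
  | @value x₁ y₁ v hv hw =>
    cases hB' with
    | body hv' hα' hb' hd' =>
      have hvv := h.get hs hs' hn hn' hx hv hv'
      cases hα'; cases hvv
    | @value x₁' y₁' v' hv' hw' =>
      have hvv := h.get hs hs' hn hn' hx hv hv'
      refine .ret (h.get hs hs' hn hn' ?_ hw hw')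
      cases hvv with
      | lamVar hyy =>
        rcases hyy with ⟨rfl, rfl⟩ | ⟨h1, h2, h3⟩
        · simpa using hy
        · simpa [h1, h2] using h3

/-- What holds of all reachable crumbles. -/
structure Crumble.Inv (E : Crumble) : Prop where
  closed : E.fv = ∅
  nodup : E.dom.Nodup
  notMem_bv : ∀ x ∈ E.dom, x ∉ E.bv
  good : E.Good

/-- For closed crumbles, the last condition on well-named crumbles follows from the first. -/
theorem Crumble.wellNamed_of_closed {E : Crumble} (hc : E.fv = ∅) (hn : E.dom.Nodup)
    (hb : ∀ x ∈ E.dom, x ∉ E.bv) : E.WellNamed := by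
  refine ⟨hn, hb, ?_⟩
  rintro E₁ z b E₂ rfl
  refine ⟨fun hz => ?_, fun hz => ?_⟩
  · have h1 := (Crumble.fv_append_eq_empty.1 hc).1 z (by simp [Crumble.fv, hz])
    rw [Crumble.dom_append, List.nodup_append'] at hn
    exact hn.2.2 (List.mem_reverse.2 h1) (by simp [Crumble.dom])
  · have := Env.fv_subset_append (E₁.snoc z b) E₂ hz
    simp [hc] at this

theorem Crumble.Inv.append_plug {C : ECtx} {b : Bite} {Ev : Env}
    (h : ((C.plug b).append Ev).Inv) :
    Env.Scoped Ev ∧ (Env.dom Ev).Nodup ∧ (∀ z ∈ C.fv, z ∈ Env.dom Ev) ∧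
      (∀ z ∈ b.fv, z ∈ Env.dom Ev) := by
  obtain ⟨h1, h2⟩ := Crumble.fv_append_eq_empty.1 h.closed
  have h3 := h.nodup
  rw [Crumble.dom_append, List.nodup_append', List.nodup_reverse] at h3
  simp only [ECtx.fv_plug, Finset.mem_union] at h1
  exact ⟨h2, h3.1, fun z hz => h1 z (.inl hz), fun z hz => h1 z (.inr hz)⟩

/-- The common shape of the two kinds of transitions. -/
inductive Crumble.Unfolds : Crumble → Crumble → Prop
  | mk (C : ECtx) (x y : Var) (Ev : Env) (B : Crumble) (hEv : Env.IsV Ev)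
      (hB : Env.Unfolds Ev x y B) (hC : ∀ w ∈ B.dom, w ∉ C.fv) :
      Crumble.Unfolds ((C.plug (.app x y)).append Ev) ((C.plugCrumble B).append Ev)

theorem StepCr.unfolds {E E' : Crumble} (h : StepCr E E') : Crumble.Unfolds E E' := by
  rcases h with h | h
  · cases h with
    | mk C x y Ev v x₁ E hEv hx hα hfresh hy hwn =>
      refine .mk C x y Ev _ hEv (.body hx ?_ hy.1 hy.2) fun w hw hw' => ?_
      · exact (Bite.alphaRel_of_alpha _ _ _ hα).mono fun _ _ _ _ => id
      · rw [Crumble.dom_subst] at hw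
        refine hfresh w hw (Crumble.names_subset_append _ _ (Crumble.fv_subset_names _ ?_))
        rw [ECtx.fv_plug]
        exact Finset.mem_union_left _ hw'
  · cases h with
    | mk C x y Ev x₁ y₁ v hEv hx hv =>
      exact .mk C x y Ev (.ret v) hEv (.value hx hv) (by simp [Crumble.dom])

theorem Crumble.Unfolds.closed {E E' : Crumble} (h : E.Unfolds E') (hE : E.Inv) : E'.fv = ∅ := by
  cases h with
  | mk C x y Ev B hEv hB hC =>
    obtain ⟨hs, hn, hCf, hxy⟩ := hE.append_plug
    refine Crumble.fv_append_eq_empty.2 ⟨fun z hz => ?_, hs⟩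
    rcases Finset.mem_union.1 (ECtx.fv_plugCrumble _ _ hz) with hz | hz
    · exact hCf z hz
    · exact hB.fv_subset hs (hxy y (by simp [Bite.fv])) z hz

theorem Crumble.Unfolds.good {E E' : Crumble} (h : E.Unfolds E') (hE : E.Good) : E'.Good := by
  cases h with
  | mk C x y Ev B hEv hB hC =>
    obtain ⟨h1, h2⟩ := hE.of_append
    obtain ⟨h3, -, h4⟩ := ECtx.good_plug.1 h1
    exact (ECtx.good_plugCrumble h3 (h4 id) (hB.good h2) hC).append h2 hEv

theorem StepCr.inv {E E' : Crumble} (h : StepCr E E') (hE : E.Inv) : E'.Inv := by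
  have hu := h.unfolds
  refine ⟨hu.closed hE, ?_, ?_, hu.good hE.good⟩
  · rcases h with h | h
    · cases h; rename_i hwn; exact hwn.1
    · cases h
      have := hE.nodup
      rw [Crumble.dom_append, ECtx.dom_plug] at this ⊢
      exact this
  · rcases h with h | h
    · cases h; rename_i hwn; exact hwn.2.1
    · cases h with
      | mk C x y Ev x₁ y₁ v hEv hx hv =>
        have := hE.notMem_bv
        intro z hz hz'
        rw [Crumble.dom_append, ECtx.dom_plug] at this hz
        refine this z hz ?_
        rw [Crumble.mem_bv_append, ECtx.bv_plug, Finset.mem_union] at hz' ⊢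
        rcases hz' with (hz' | hz') | hz'
        · exact .inl (.inl hz')
        · obtain ⟨e, he, rfl⟩ := Env.mem_of_get hv
          exact .inr ⟨e, he, hz'⟩
        · exact .inr hz'

theorem Crumble.Unfolds.betaV {E E' : Crumble} (h : E.Unfolds E') (hE : E.Inv) :
    BetaV E.readBack E'.readBack := by
  cases h with
  | mk C x y Ev B hEv hB hC =>
    obtain ⟨hs, hn, -⟩ := hE.append_plug
    obtain ⟨t, hx, ht⟩ := hB.sem_eq hs hn
    obtain ⟨R, hR⟩ := (ECtx.good_plug.1 hE.good.of_append.1).2.2 id _ (Env.isValue_sem hEv)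
    refine ⟨R, t, Env.sem .fvar Ev y, Env.isValue_sem hEv y, ?_, ?_⟩
    · rw [Crumble.readBack_eq_sem, Crumble.sem_append, ECtx.sem_plug, hR, Bite.sem, hx]
    · rw [Crumble.readBack_eq_sem, Crumble.sem_append, ECtx.sem_plugCrumble _ _ _ hC, hR, ht]

theorem Crumble.Unfolds.alphaRel {E₁ E₂ E₁' E₂' : Crumble} (h₁ : E₁.Unfolds E₁')
    (h₂ : E₂.Unfolds E₂') (hi₁ : E₁.Inv) (hi₂ : E₂.Inv) {R : Var → Var → Prop}
    (h : E₁.AlphaRel R E₂) : E₁'.AlphaRel R E₂' := by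
  cases h₁ with
  | mk C x y Ev B hEv hB hC =>
    cases h₂ with
    | mk C' x' y' Ev' B' hEv' hB' hC' =>
      -- The two redexes are the rightmost applications, hence at the same position.
      have hl := h.numValues_eq
      rw [Crumble.numValues_append hEv, Crumble.numValues_append hEv',
        ECtx.numValues_plug_app, ECtx.numValues_plug_app, Nat.zero_add, Nat.zero_add] at hl
      obtain ⟨S, hS, hc⟩ := Env.AlphaRel.of_append hl h
      obtain ⟨hCC, hxy⟩ := ECtx.AlphaRel.of_plug hc
      obtain ⟨hs, hn, -⟩ := hi₁.append_plug
      obtain ⟨hs', hn', -⟩ := hi₂.append_plug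
      cases hxy with
      | app hx hy =>
        exact hS.append (hCC.plugCrumble (hB.alphaRel hS hs hs' hn hn' hx hy hB') hC hC')

/-- A crumble is cut at its rightmost application, or it consists of values. -/
theorem Crumble.exists_cut : ∀ (E : Crumble) (Ev : Env), Env.IsV Ev →
    (∃ (C : ECtx) (x y : Var) (Ev' : Env), Env.IsV Ev' ∧
      E.append Ev = (C.plug (.app x y)).append Ev') ∨
    ∃ (v : Bite) (Ev' : Env), v.IsValue ∧ E.append Ev = (Crumble.ret v).append Ev'
  | .ret (.app x y), Ev, h => .inl ⟨.ret, x, y, Ev, h, rfl⟩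
  | .ret (.lamVar x y), Ev, _ => .inr ⟨.lamVar x y, Ev, trivial, rfl⟩
  | .ret (.lam x E), Ev, _ => .inr ⟨.lam x E, Ev, trivial, rfl⟩
  | .snoc E z (.app x y), Ev, h => .inl ⟨.snoc E z, x, y, Ev, h, rfl⟩
  | .snoc E z (.lamVar x y), Ev, h => Crumble.exists_cut E ((z, .lamVar x y) :: Ev)
      (by simpa [Env.IsV, Bite.IsValue] using h)
  | .snoc E z (.lam x F), Ev, h => Crumble.exists_cut E ((z, .lam x F) :: Ev)
      (by simpa [Env.IsV, Bite.IsValue] using h)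

theorem Crumble.dom_sublist_allDom : ∀ (E : Crumble), E.dom.Sublist E.allDom
  | .ret _ => List.nil_sublist _
  | .snoc E _ _ => ((Crumble.dom_sublist_allDom E).trans (List.sublist_append_left _ _)).cons_cons _

/-- A crumble that satisfies the invariant and has an application can make a transition. -/
theorem exists_stepCr {C : ECtx} {x y : Var} {Ev : Env} (hEv : Env.IsV Ev)
    (h : ((C.plug (.app x y)).append Ev).Inv) :
    ∃ E', StepCr ((C.plug (.app x y)).append Ev) E' := by
  obtain ⟨hs, hn, hCf, hxy⟩ := h.append_plug
  obtain ⟨v, hv⟩ := Env.exists_get (hxy x (by simp [Bite.fv]))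
  have hy := hxy y (by simp [Bite.fv])
  obtain ⟨e, he, hev⟩ := Env.mem_of_get hv
  have hval : v.IsValue := hev ▸ hEv e he
  cases v with
  | app => exact hval.elim
  | lamVar x₁ y₁ =>
    obtain ⟨w, hw⟩ : ∃ w, Env.get (if y₁ = x₁ then y else y₁) Ev = some w := by
      apply Env.exists_get
      split_ifs with h1
      · exact hy
      · exact Env.fv_of_get hs hv y₁ (by simp [Bite.fv, h1])
    exact ⟨_, .inr (.mk C x y Ev x₁ y₁ w hEv hv hw)⟩
  | lam x₀ E₀ =>
    -- Rename the abstraction apart from the whole crumble.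
    obtain ⟨b, hα, hbn, hbd, hbb⟩ := Bite.exists_fresh (.lam x₀ E₀) (R := VarAlpha [])
      ((C.plug (.app x y)).append Ev).names fun z hz =>
        ⟨z, Crumble.dom_subset_names_append _ _ z (Env.fv_of_get hs hv z hz), rfl⟩
    cases hα with
    | @lam _ _ x₁ _ E hE =>
      simp only [Bite.bv, Finset.mem_insert, Bite.allDom, not_or, forall_eq_or_imp] at hbn hbd hbb
      have hyn := Crumble.dom_subset_names_append (C.plug (.app x y)) Ev y hy
      have hfresh : ∀ w ∈ E.dom, w ∉ ((C.plug (.app x y)).append Ev).names :=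
        fun w hw => (hbd w (E.dom_subset_allDom hw)).1
      have hyE : y ∉ E.bv ∧ y ∉ E.allDom := ⟨fun h => hbb.2 y h hyn, fun h => (hbd y h).1 hyn⟩
      have hα' : (Bite.lam x₀ E₀).AlphaRel Eq (.lam x₁ E) :=
        (Bite.AlphaRel.lam hE).mono fun _ _ _ _ => id
      have hC : ∀ w ∈ (E.subst x₁ y).dom, w ∉ C.fv := fun w hw hw' => by
        rw [Crumble.dom_subst] at hw
        exact hfresh w hw (Crumble.dom_subset_names_append _ _ w (hCf w hw'))
      have hcl := (Crumble.Unfolds.mk C x y Ev _ hEv (.body hv hα' hyE.1 hyE.2) hC).closed h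
      have hdn : ∀ w ∈ (Env.dom Ev).reverse ++ C.dom,
          w ∈ ((C.plug (.app x y)).append Ev).names := fun w hw =>
        Crumble.dom_subset_names _ w (by rwa [Crumble.dom_append, ECtx.dom_plug])
      have h1 := h.nodup
      have h2 := h.notMem_bv
      rw [Crumble.dom_append, ECtx.dom_plug] at h1 h2
      refine ⟨_, .inl (.mk C x y Ev _ x₁ E hEv hv (Bite.AlphaRel.lam hE).alpha hfresh hyE
        (Crumble.wellNamed_of_closed hcl ?_ ?_))⟩
      · rw [Crumble.dom_append, ECtx.dom_plugCrumble, Crumble.dom_subst]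
        have hp : ((Env.dom Ev).reverse ++ (E.dom ++ C.dom)).Perm
            (E.dom ++ ((Env.dom Ev).reverse ++ C.dom)) := by
          rw [← List.append_assoc, ← List.append_assoc]
          exact List.perm_append_comm.append_right _
        rw [hp.nodup_iff, List.nodup_append']
        exact ⟨hbn.sublist E.dom_sublist_allDom, h1, fun w hw hw' => hfresh w hw (hdn w hw')⟩
      · intro w hw hw'
        rw [Crumble.dom_append, ECtx.dom_plugCrumble, Crumble.dom_subst] at hw
        rw [Crumble.mem_bv_append, ECtx.bv_plugCrumble, Crumble.bv_subst, Finset.mem_union,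
          or_assoc, or_left_comm] at hw'
        have hold : (w ∈ C.bv ∨ ∃ e ∈ Ev, w ∈ e.2.bv) →
            w ∈ ((C.plug (.app x y)).append Ev).bv := fun hw => by
          rw [Crumble.mem_bv_append, ECtx.bv_plug, Finset.mem_union]
          exact hw.imp .inl id
        have hw : w ∈ E.dom ∨ w ∈ (Env.dom Ev).reverse ++ C.dom := by
          simp only [List.mem_append] at hw ⊢; tauto
        rcases hw with hw | hw <;> rcases hw' with hw' | hw'
        · exact (hbd w (E.dom_subset_allDom hw)).2.2 hw'
        · exact hfresh w hw (Crumble.bv_subset_names _ (hold hw'))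
        · exact hbb.2 w hw' (hdn w hw)
        · exact h2 w hw (hold hw')

theorem Crumb.inv {t : Term} {E : Crumble} (ht : t.Closed) (h : Crumb t E) : E.Inv where
  closed := by
    have := h.1.fv_subset
    rwa [ht.2, Finset.subset_empty] at this
  nodup := h.2.1.sublist E.dom_sublist_allDom
  notMem_bv x hx := (h.2.2 x (E.dom_subset_allDom hx)).2
  good := h.1.good h.2

theorem Reachable.inv {E : Crumble} (h : Reachable E) : E.Inv := by
  obtain ⟨t, E₀, ht, hE₀, hr⟩ := h
  induction hr with
  | refl => exact hE₀.inv ht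
  | tail _ hs ih => exact hs.inv ih

/-! ### Call-by-value reduction -/

theorem RCtx.not_isValue_plug (R : RCtx) (t u : Term) : ¬ (R.plug (.app t u)).IsValue := by
  cases R <;> exact id

theorem RCtx.plug_redex_inj {R R' : RCtx} {t v t' v' : Term} (hv : v.IsValue) (hv' : v'.IsValue)
    (h : R.plug (.app (.lam t) v) = R'.plug (.app (.lam t') v')) : R = R' ∧ t = t' ∧ v = v' := by
  induction R generalizing R' with
  | hole =>
    cases R' with
    | hole => cases h; exact ⟨rfl, rfl, rfl⟩
    | appR u R' => exact (R'.not_isValue_plug _ _ ((app.inj h).2 ▸ hv)).elim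
    | appL R' u hu =>
      exact (R'.not_isValue_plug (.lam t') v' ((app.inj h).1 ▸ (trivial : (Term.lam t).IsValue))).elim
  | appR s R ih =>
    cases R' with
    | hole => exact (R.not_isValue_plug _ _ ((app.inj h).2.symm ▸ hv')).elim
    | appR u R' =>
      obtain ⟨h1, h2⟩ := app.inj h
      obtain ⟨rfl, h3⟩ := ih h2
      exact ⟨by rw [h1], h3⟩
    | appL R' u hu => exact (R.not_isValue_plug _ _ ((app.inj h).2.symm ▸ hu)).elim
  | appL R s hs ih =>
    cases R' with
    | hole =>
      exact (R.not_isValue_plug (.lam t) v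
        ((app.inj h).1.symm ▸ (trivial : (Term.lam t').IsValue))).elim
    | appR u R' => exact (R'.not_isValue_plug _ _ ((app.inj h).2 ▸ hs)).elim
    | appL R' u hu =>
      obtain ⟨h1, h2⟩ := app.inj h
      obtain ⟨rfl, h3⟩ := ih h1
      subst h2
      exact ⟨rfl, h3⟩

theorem BetaV.deterministic {s u u' : Term} (h : BetaV s u) (h' : BetaV s u') : u = u' := by
  obtain ⟨R, t, v, hv, rfl, rfl⟩ := h
  obtain ⟨R', t', v', hv', hs, rfl⟩ := h'
  obtain ⟨rfl, rfl, rfl⟩ := RCtx.plug_redex_inj hv hv' hs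
  rfl

theorem IsValue.not_betaV {s u : Term} (hs : s.IsValue) : ¬ BetaV s u := by
  rintro ⟨R, t, v, -, rfl, -⟩
  exact R.not_isValue_plug _ _ hs

/-- A crumble that satisfies the invariant and has no transition consists of values, and reads back
to an abstraction. -/
theorem Crumble.Inv.not_betaV {E : Crumble} (hE : E.Inv) (h : ¬ ∃ E', StepCr E E') (u : Term) :
    ¬ BetaV E.readBack u := by
  rcases E.exists_cut [] (by simp [Env.IsV]) with ⟨C, x, y, Ev, hEv, he⟩ | ⟨v, Ev, hv, he⟩
  · change E = _ at he
    subst he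
    exact (h (exists_stepCr hEv hE)).elim
  · change E = _ at he
    subst he
    apply IsValue.not_betaV
    rw [Crumble.readBack_eq_sem, Crumble.sem_append, Crumble.sem]
    revert hv
    cases v <;> exact id

/-! ### Implementation systems -/

/-- In an implementation system without overhead transitions, executions and derivations match. -/
theorem Machine.IsImplementationSystem.matches {Λ : Type} {M : Machine Λ} {T : Set Λ}
    {r : Λ → Λ → Prop} (h : M.IsImplementationSystem T r) (ho : ∀ s s', ¬ M.overhead s s') :
    M.Matches T r where
  exec_to_deriv t ht s₀ hs₀ n s hs := by
    have key : ∀ {n s₀ s}, M.Exec n s₀ s → Deriv r n (M.decode s₀) (M.decode s) := by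
      intro n s₀ s hs
      induction hs with
      | refl => exact .refl _
      | principal _ hs ih => exact .tail ih (h.principal_projection _ _ hs)
      | overhead _ hs => exact (ho _ _ hs).elim
    exact h.initialization t ht s₀ hs₀ ▸ key hs
  deriv_to_exec t ht s₀ hs₀ n u hu := by
    induction hu with
    | refl => exact ⟨s₀, .refl _, h.initialization _ ht s₀ hs₀⟩
    | @tail n t u w _ hr ih =>
      obtain ⟨s, hs, rfl⟩ := ih ht hs₀
      -- A state that decodes to a reducible term is not final, and its transition decodes to the
      -- only possible step.
      obtain ⟨s', hs'⟩ := not_imp_not.1 (h.halt s) ⟨w, hr⟩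
      have hp := hs'.resolve_right (ho _ _)
      exact ⟨s', .principal hs hp, h.strategy_deterministic _ (h.decode_mem s) _ _
        (h.principal_projection _ _ hp) hr⟩

theorem Crumble.Alpha.readBack_eq {E E' : Crumble} (h : E.Alpha [] E') :
    E.readBack = E'.readBack := by
  rw [Crumble.readBack_eq_sem, Crumble.readBack_eq_sem]
  exact (Crumble.alphaRel_of_alpha _ _ _ h).sem_eq fun _ _ => congrArg _

theorem Crumble.Alpha.equivalence : Equivalence fun E E' : Crumble => E.Alpha [] E' where
  refl E := (Crumble.AlphaRel.refl E (R := VarAlpha []) fun _ _ => rfl).alpha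
  symm h := ((Crumble.alphaRel_of_alpha _ _ _ h).symm (S := VarAlpha []) fun _ _ => Eq.symm).alpha
  trans h h' := ((Crumble.alphaRel_of_alpha _ _ _ h).comp (Crumble.alphaRel_of_alpha _ _ _ h')
    (T := VarAlpha []) fun _ _ _ => Eq.trans).alpha

theorem Crumb.exists_of_closed {t : Term} (ht : t.Closed) : ∃ E, Crumb t E := by
  rcases exists_translates _ t le_rfl ht.1 t.fv (Finset.Subset.refl _) with ⟨y, rfl⟩ | ⟨E, hE, hf, -⟩
  · exact absurd ht.2 (Finset.singleton_ne_empty y)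
  · exact ⟨E, hE, hf⟩

theorem Crumb.alpha {t : Term} {E E' : Crumble} (h : Crumb t E) (h' : Crumb t E') :
    E.Alpha [] E' :=
  (h.1.alphaRel h.2 h'.1 h'.2 (R := VarAlpha []) (ρ := .fvar) (ρ' := .fvar) (fun _ => trivial)
    (fun _ => trivial) (fun _ _ => fvar.inj) rfl).alpha

theorem finestMachine_isImplementationSystem :
    finestMachine.IsImplementationSystem {t : Term | t.Closed} BetaV where
  strategy_deterministic _ _ _ _ := BetaV.deterministic
  equivalence := ⟨fun s => Crumble.Alpha.equivalence.refl s.1,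
    fun h => Crumble.Alpha.equivalence.symm h, fun h h' => Crumble.Alpha.equivalence.trans h h'⟩
  decode_equiv _ _ h := h.readBack_eq
  decode_mem s := ⟨s.1.lcAt_readBack,
    Finset.subset_empty.1 (s.2.inv.closed ▸ s.1.fv_readBack)⟩
  encodes_exists t ht := by
    obtain ⟨E, hE⟩ := Crumb.exists_of_closed ht
    exact ⟨⟨E, t, E, ht, hE, .refl⟩, hE⟩
  encodes_unique _ _ _ _ h h' := h.alpha h'
  initialization _ _ _ h := h.1.readBack h.2
  principal_projection s _ h := h.unfolds.betaV s.2.inv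
  overhead_transparency _ _ h := h.elim
  determinism s₁ s₂ _ _ h h₁ h₂ :=
    ((h₁.resolve_right id).unfolds.alphaRel (h₂.resolve_right id).unfolds s₁.2.inv s₂.2.inv
      (Crumble.alphaRel_of_alpha _ _ _ h)).alpha
  halt s h := by
    rintro ⟨u, hu⟩
    refine s.2.inv.not_betaV ?_ u hu
    rintro ⟨E', hE'⟩
    obtain ⟨t, E₀, ht, hE₀, hr⟩ := s.2
    exact h ⟨⟨E', t, E₀, ht, hE₀, hr.tail hE'⟩, .inl hE'⟩
  overhead_termination := ⟨fun _ => ⟨_, fun _ h => h.elim⟩⟩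

end Crumbling

theorem mainTheorem1 :
    Crumbling.finestMachine.IsImplementationSystem
        {t : Crumbling.Term | t.Closed} Crumbling.BetaV ∧
      Crumbling.finestMachine.Matches {t : Crumbling.Term | t.Closed} Crumbling.BetaV :=
  ⟨Crumbling.finestMachine_isImplementationSystem,
    Crumbling.finestMachine_isImplementationSystem.matches fun _ _ => id⟩
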